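/- **Setting.** Write $\mathrm{ReLU}(z)=\max\{z,0\}$ and $H_c(z)=\tfrac12\mathrm{ReLU}(z)^2-cz$. Fix $n\ge 1$ boxes with opening costs $c_1,\dots,c_n>0$, a measurable map $h:\mathbb R^d\times\mathbb R^d\to\mathbb R$, a parameter set $W\subseteq\mathbb R^d$ and a set $Y\subseteq\mathbb R$ of possible values (e.g. $W=\mathbb R^d$, $Y=\mathbb R$). Fix a feedback model (full information or costly feedback) and an adversary model (oblivious, or adaptive: the adversary may react to all past rounds and to the current predictions). *Online regression with loss $H_c$.* In each round $t\le T$ a (randomized) learner chooses a prediction $w_t\in\mathbb R^d$, then an adversary chooses a pair $(x_t,y_t)$ with $\|x_t\|_2\le 1$, $y_t\in Y$. With full information the learner always sees the pair and the acquisition cost is $a=0$; with costly feedback the learner sees it only in the rounds in which it requests it, and pays $a=c$ per request. The learner has expected regret at most $R$ if, for every adversary of the given model and every $w\in W$, $$\mathbb E\Big[\sum_{t=1}^T H_c(h(w_t,x_t)-y_t)-\sum_{t=1}^T H_c(h(w,x_t)-y_t)+a\cdot\#\{\text{requests}\}\Big]\le R,$$ the random variable in the bracket being integrable. *Pandora's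 Box.* Weitzman's algorithm with reservation values $\sigma_1,\dots,\sigma_n$ opens the boxes in increasing order of $\sigma_i$ (ties broken by index), box $i$ costing $c_i$ and revealing $v_i$; it stops as soon as the smallest value seen is strictly less than the reservation value of the next box, or when all boxes are open, and collects the smallest value seen. $\mathrm{WEITZ}_{D}(\sigma;c)$ is the expectation of the collected value plus the opening costs when $v_i\sim D_i$ independently. *Contextual Pandora's Box.* In round $t$ the environment (randomized, and of the given adversary model) chooses distributions $D_{t,1},\dots,D_{t,n}$ on $\mathbb R$ with values in $Y$ and contexts $x_{t,i}\in\mathbb R^d$, $\|x_{t,i}\|_2\le 1$; the values $v_{t,i}\sim D_{t,i}$ are realized independently. *Realizability:* there are $w_1^*,\dots,w_n^*\in W$ such that always $\mathbb E_{v\sim D_{t,i}}[\mathrm{ReLU}(\sigma^*_{t,i}-v)]=c_i$, where $\sigma^*_{t,i}=h(w_i^*,x_{t,i})$. The expectations of $|v_{t,i}|$ and $|H_{c_i}(\sigma^*_{t,i}-v_{t,i})|$ over the run are assumed finite. *Algorithm CPB.* For each box $i$ run an independent copy $\mathcal O_i$ of the oracle with loss $H_{c_i}$ (which may depend on the horizon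 $T$). In round $t$, get the prediction $w_{t,i}$ of $\mathcal O_i$, run Weitzman's algorithm with reservation values $\sigma_{t,i}=h(w_{t,i},x_{t,i})$, and then give $(x_{t,i},v_{t,i})$ to $\mathcal O_i$: always with full information, and if $\mathcal O_i$ requests it with costly feedback, in which case box $i$ is opened at cost $c_i$ unless Weitzman's algorithm already opened it. Let $C_t$ be the cost (collected value plus opening costs) of Weitzman's algorithm in round $t$, and $E_t$ the total cost of the extra boxes opened because of requests ($E_t=0$ with full information). Put $$\mathrm{Regret}_0(T)=\mathbb E\sum_{t=1}^T\big(C_t-\mathrm{WEITZ}_{D_t}(\sigma_t^*;c)\big),\qquad \mathrm{Regret}(T)=\mathbb E\sum_{t=1}^T\big(C_t+E_t-\mathrm{WEITZ}_{D_t}(\sigma_t^*;c)\big).$$ **Theorem.** Suppose that for every $T$ and every $i$ the oracle for the loss $H_{c_i}$ and the horizon $T$ has expected regret at most $r(T)$. Then for every $T$ and every environment as above both regrets are well defined (the random variables are integrable), and 1. $\mathrm{Regret}_0(T)\le 2n\sqrt{T\,r(T)}$; 2. with full information, and with costly feedback whenever $r(T)\le 2T$, $\ \mathrm{Regret}(T)\le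 2n\sqrt{T\,r(T)}$; 3. if $r(T)=o(T)$, then $\mathrm{Regret}(T)$ is sublinear, uniformly in the environment: for every $\varepsilon>0$ there is $T_0$ such that $\mathrm{Regret}(T)\le\varepsilon T$ for all $T\ge T_0$ and all environments as above. -/

import Mathlib

open MeasureTheory Filter Asymptotics

noncomputable section

/-- The parameter and context space `ℝ^d` with the Euclidean norm. -/
abbrev Vec (d : ℕ) : Type := EuclideanSpace ℝ (Fin d)

/-- `ReLU(z) = max{z, 0}`. -/
def relu (z : ℝ) : ℝ := max z 0

/-- The linear-quadratic loss `H_c(z) = ½ ReLU(z)² - c z`. -/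
def linQuadLoss (c z : ℝ) : ℝ := 1 / 2 * relu z ^ 2 - c * z

/-! ### Weitzman's algorithm

`Tuple.sort σ k` is the `k`-th box (counting from `0`) in the order of increasing `σ`, ties being
broken by the index of the box. -/

/-- Having opened the boxes in positions `0, …, k`, Weitzman's algorithm stops because there is a
next box and the smallest value seen so far lies strictly below its reservation value. -/
def weitzmanStopsAfter {n : ℕ} (σ v : Fin n → ℝ) (k : ℕ) : Prop :=
  ∃ hk : k + 1 < n, ∃ l : Fin n, (l : ℕ) ≤ k ∧ v (Tuple.sort σ l) < σ (Tuple.sort σ ⟨k + 1, hk⟩)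

open Classical in
/-- The set of boxes opened by Weitzman's algorithm with reservation values `σ` when the boxes
contain the values `v`: box `i` is opened iff the algorithm did not stop at an earlier position. -/
def weitzmanOpened {n : ℕ} (σ v : Fin n → ℝ) : Finset (Fin n) :=
  Finset.univ.filter fun i => ∀ k < ((Tuple.sort σ).symm i : ℕ), ¬ weitzmanStopsAfter σ v k

theorem weitzmanOpened_nonempty {n : ℕ} [NeZero n] (σ v : Fin n → ℝ) :
    (weitzmanOpened σ v).Nonempty :=
  ⟨Tuple.sort σ 0, by simp [weitzmanOpened]⟩

/-- The cost of one execution of Weitzman's algorithm: smallest value found plus opening costs. -/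
def weitzmanCost {n : ℕ} [NeZero n] (c σ v : Fin n → ℝ) : ℝ :=
  (weitzmanOpened σ v).inf' (weitzmanOpened_nonempty σ v) v + ∑ i ∈ weitzmanOpened σ v, c i

/-- `WEITZ_D(σ; c)`: expected cost of Weitzman's algorithm with reservation values `σ` when the
values are drawn independently, `v i ∼ D i`. -/
def weitz {n : ℕ} [NeZero n] (D : Fin n → Measure ℝ) (σ c : Fin n → ℝ) : ℝ :=
  ∫ v, weitzmanCost c σ v ∂(Measure.pi D)

/-! ### Feedback and adversary models -/

/-- Full information: input-output pairs are always revealed, at no cost.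
Costly feedback (the bandit setting): a pair is revealed iff it is requested and paid for. -/
inductive FeedbackModel
  | fullInformation
  | costly

/-- The information acquisition cost `a` for a box of opening cost `c`. -/
def FeedbackModel.acquisitionCost : FeedbackModel → ℝ → ℝ
  | .fullInformation, _ => 0
  | .costly, c => c

/-- An oblivious adversary does not react to the learner; an adaptive one may react to all past
rounds and to the current prediction. -/
inductive AdversaryModel
  | oblivious
  | adaptive

/-- What an online regression learner does in a round: (prediction, request of the pair?). -/
abbrev Move (d : ℕ) : Type := Vec d × Bool

/-- An input-output pair `(x, y)`. -/
abbrev Pair (d : ℕ) : Type := Vec d × ℝ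

/-- The record of a round of online regression. -/
abbrev Round (d : ℕ) : Type := Move d × Pair d

/-- What the learner sees at the end of a round: nothing, or the input-output pair. -/
abbrev Observation (d : ℕ) : Type := Unit ⊕ Pair d

/-- The observation resulting from a round. -/
def observe {d : ℕ} : FeedbackModel → Round d → Observation d
  | .fullInformation, ρ => Sum.inr ρ.2
  | .costly, ρ => if ρ.1.2 = true then Sum.inr ρ.2 else Sum.inl ()

/-! ### Online regression -/

/-- An oracle: a randomized algorithm for online regression. All its randomness is in a seed drawn
from `law` in advance; its prediction and its decision to request the pair of round `t` are
functions of the seed and of the observations made in the rounds before `t`. -/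
structure Oracle (d : ℕ) where
  Seed : Type
  [measurableSpaceSeed : MeasurableSpace Seed]
  law : Measure Seed
  [isProbabilityMeasure_law : IsProbabilityMeasure law]
  predict : (t : ℕ) → Seed → (Fin t → Observation d) → Vec d
  request : (t : ℕ) → Seed → (Fin t → Observation d) → Bool
  measurable_predict : ∀ t, Measurable fun p : Seed × (Fin t → Observation d) => predict t p.1 p.2
  measurable_request : ∀ t, Measurable fun p : Seed × (Fin t → Observation d) => request t p.1 p.2

attribute [instance] Oracle.measurableSpaceSeed Oracle.isProbabilityMeasure_law

/-- The action of the oracle in round `t` after the rounds `past`. -/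
def Oracle.act {d : ℕ} (O : Oracle d) (fm : FeedbackModel) (t : ℕ) (s : O.Seed)
    (past : Fin t → Round d) : Move d :=
  (O.predict t s fun j => observe fm (past j), O.request t s fun j => observe fm (past j))

/-- An adversary for online regression: it chooses the pair of round `t` after seeing the learner's
past actions and its current prediction. Inputs lie in the unit ball. -/
structure Adversary (d : ℕ) where
  choose : (t : ℕ) → (Fin t → Move d) × Vec d → Pair d
  measurable_choose : ∀ t, Measurable (choose t)
  norm_input_le : ∀ t z, ‖(choose t z).1‖ ≤ 1

/-- The adversary is allowed by the adversary model. -/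
def Adversary.Respects {d : ℕ} (adv : Adversary d) : AdversaryModel → Prop
  | .oblivious => ∀ t z z', adv.choose t z = adv.choose t z'
  | .adaptive => True

/-- The first `t` rounds of the oracle with seed `s` against an adversary. -/
def Oracle.transcript {d : ℕ} (O : Oracle d) (fm : FeedbackModel) (adv : Adversary d)
    (s : O.Seed) : (t : ℕ) → Fin t → Round d
  | 0 => fun j => j.elim0
  | t + 1 =>
    let past := O.transcript fm adv s t
    let a := O.act fm t s past
    Fin.snoc (α := fun _ => Round d) past (a, adv.choose t (fun j => (past j).1, a.1))

/-- The realized regret after `T` rounds relative to the fixed parameter `w`, with loss `H_c` and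
acquisition cost `a`:
`∑ H_c(h(w_t, x_t) - y_t) - ∑ H_c(h(w, x_t) - y_t) + a · (number of requested pairs)`. -/
def Oracle.regret {d : ℕ} (O : Oracle d) (fm : FeedbackModel) (adv : Adversary d)
    (h : Vec d → Vec d → ℝ) (c a : ℝ) (T : ℕ) (w : Vec d) (s : O.Seed) : ℝ :=
  let ρ := O.transcript fm adv s T
  ∑ t, linQuadLoss c (h (ρ t).1.1 (ρ t).2.1 - (ρ t).2.2)
    - ∑ t, linQuadLoss c (h w (ρ t).2.1 - (ρ t).2.2)
    + a * ((Finset.univ.filter fun t => (ρ t).1.2 = true).card : ℝ)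

/-- The oracle achieves expected regret at most `R` over `T` rounds for online regression with loss
`H_c`, parameter set `W` and outcomes in `Y`, against all adversaries of the given model. -/
def Oracle.AchievesRegret {d : ℕ} (O : Oracle d) (fm : FeedbackModel) (am : AdversaryModel)
    (h : Vec d → Vec d → ℝ) (W : Set (Vec d)) (Y : Set ℝ) (c : ℝ) (T : ℕ) (R : ℝ) : Prop :=
  ∀ adv : Adversary d, adv.Respects am → (∀ t z, (adv.choose t z).2 ∈ Y) → ∀ w ∈ W,
    Integrable (O.regret fm adv h c (fm.acquisitionCost c) T w) O.law ∧
    ∫ s, O.regret fm adv h c (fm.acquisitionCost c) T w s ∂O.law ≤ R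

/-! ### Contextual Pandora's Box -/

/-- What the environment can see when it moves in round `t`: for each earlier round and each box
the prediction, the request, the context and the value; and the current predictions. -/
abbrev History (n d t : ℕ) : Type := (Fin t → Fin n → Round d) × (Fin n → Vec d)

/-- An environment for Contextual Pandora's Box with `n` boxes, with private randomness `Seed`.
In round `t` it chooses the contexts and the value distributions `dist t z i`. The values are
realized independently: box `i` contains `sample t z i u` with fresh `u` uniform on `[0,1]`, whose
law is `dist t z i` (every measurable choice of probability measures on `ℝ` can be sampled so). -/
structure Environment (n d : ℕ) where
  Seed : Type
  [measurableSpaceSeed : MeasurableSpace Seed]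
  law : Measure Seed
  [isProbabilityMeasure_law : IsProbabilityMeasure law]
  context : (t : ℕ) → Seed × History n d t → Fin n → Vec d
  dist : (t : ℕ) → Seed × History n d t → Fin n → Measure ℝ
  sample : (t : ℕ) → Seed × History n d t → Fin n → unitInterval → ℝ
  measurable_context : ∀ t i, Measurable fun z => context t z i
  measurable_sample : ∀ t i,
    Measurable fun p : (Seed × History n d t) × unitInterval => sample t p.1 i p.2
  map_sample : ∀ t z i, (volume : Measure unitInterval).map (sample t z i) = dist t z i
  norm_context_le : ∀ t z i, ‖context t z i‖ ≤ 1

attribute [instance] Environment.measurableSpaceSeed Environment.isProbabilityMeasure_law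

/-- The environment is allowed by the adversary model; an oblivious one chooses all contexts and
distributions (possibly at random) independently of what happens in the rounds. -/
def Environment.Respects {n d : ℕ} (env : Environment n d) : AdversaryModel → Prop
  | .oblivious => ∀ t e z z', env.context t (e, z) = env.context t (e, z') ∧
      env.dist t (e, z) = env.dist t (e, z') ∧ env.sample t (e, z) = env.sample t (e, z')
  | .adaptive => True

/-- The realizability assumption, with parameters `wstar i`. -/
def Environment.Realizable {n d : ℕ} (env : Environment n d) (h : Vec d → Vec d → ℝ)
    (c : Fin n → ℝ) (wstar : Fin n → Vec d) : Prop :=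
  ∀ t z i, ∫ v, relu (h (wstar i) (env.context t z i) - v) ∂(env.dist t z i) = c i

/-- The data of Algorithm CPB: the map `h`, the opening costs, the feedback model, and for every
box its own copy of the oracle. -/
structure CPB (n d : ℕ) where
  h : Vec d → Vec d → ℝ
  cost : Fin n → ℝ
  feedback : FeedbackModel
  oracle : Fin n → Oracle d

/-- Algorithm CPB for opening costs `c`: box `i` gets a copy of the oracle for the loss `H_{c i}`,
where `O a` is the oracle for the loss `H_a`. -/
def CPB.ofOracle {n d : ℕ} (h : Vec d → Vec d → ℝ) (c : Fin n → ℝ) (fm : FeedbackModel)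
    (O : ℝ → Oracle d) : CPB n d :=
  ⟨h, c, fm, fun i => O (c i)⟩

namespace CPB

variable {n d : ℕ}

/-- The randomness of a run of CPB: the seed of the environment, the uniform variables that realize
the values, and the seeds of the oracles. -/
abbrev Outcome (A : CPB n d) (env : Environment n d) : Type :=
  env.Seed × (ℕ × Fin n → unitInterval) × ((i : Fin n) → (A.oracle i).Seed)

/-- All components of the randomness are independent. -/
def prob (A : CPB n d) (env : Environment n d) : Measure (A.Outcome env) :=
  env.law.prod ((Measure.infinitePi fun _ : ℕ × Fin n => (volume : Measure unitInterval)).prod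
    (Measure.pi fun i => (A.oracle i).law))

/-- The actions of the oracles in round `t` after the rounds `past`. -/
def act (A : CPB n d) {env : Environment n d} (ω : A.Outcome env) (t : ℕ)
    (past : Fin t → Fin n → Round d) (i : Fin n) : Move d :=
  (A.oracle i).act A.feedback t (ω.2.2 i) fun j => past j i

/-- The first `t` rounds of a run: oracle `i` plays against the pairs (context of box `i`, value
of box `i`). -/
def transcript (A : CPB n d) (env : Environment n d) (ω : A.Outcome env) :
    (t : ℕ) → Fin t → Fin n → Round d
  | 0 => fun j => j.elim0
  | t + 1 =>
    let past := A.transcript env ω t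
    let z : env.Seed × History n d t := (ω.1, past, fun i => (A.act ω t past i).1)
    Fin.snoc (α := fun _ => Fin n → Round d) past fun i =>
      (A.act ω t past i, env.context t z i, env.sample t z i (ω.2.1 (t, i)))

/-- The prediction `w_{t,i}`. -/
def prediction (A : CPB n d) (env : Environment n d) (t : ℕ) (ω : A.Outcome env) (i : Fin n) :
    Vec d :=
  (A.act ω t (A.transcript env ω t) i).1

/-- Whether oracle `i` requests the pair of round `t`. -/
def requested (A : CPB n d) (env : Environment n d) (t : ℕ) (ω : A.Outcome env) (i : Fin n) :
    Bool :=
  (A.act ω t (A.transcript env ω t) i).2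

/-- The information on which the environment bases round `t`. -/
def state (A : CPB n d) (env : Environment n d) (t : ℕ) (ω : A.Outcome env) :
    env.Seed × History n d t :=
  (ω.1, A.transcript env ω t, A.prediction env t ω)

/-- The context `x_{t,i}`. -/
def context (A : CPB n d) (env : Environment n d) (t : ℕ) (ω : A.Outcome env) (i : Fin n) :
    Vec d :=
  env.context t (A.state env t ω) i

/-- The value distribution `D_{t,i}`. -/
def dist (A : CPB n d) (env : Environment n d) (t : ℕ) (ω : A.Outcome env) (i : Fin n) :
    Measure ℝ :=
  env.dist t (A.state env t ω) i

/-- The value `v_{t,i}`. -/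
def value (A : CPB n d) (env : Environment n d) (t : ℕ) (ω : A.Outcome env) (i : Fin n) : ℝ :=
  env.sample t (A.state env t ω) i (ω.2.1 (t, i))

/-- The estimated reservation value `σ_{t,i} = h(w_{t,i}, x_{t,i})`. -/
def estimate (A : CPB n d) (env : Environment n d) (t : ℕ) (ω : A.Outcome env) (i : Fin n) : ℝ :=
  A.h (A.prediction env t ω i) (A.context env t ω i)

/-- The optimal reservation value `σ*_{t,i} = h(w*_i, x_{t,i})`. -/
def optimal (A : CPB n d) (env : Environment n d) (wstar : Fin n → Vec d) (t : ℕ)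
    (ω : A.Outcome env) (i : Fin n) : ℝ :=
  A.h (wstar i) (A.context env t ω i)

/-- The Pandora's Box cost of Weitzman's algorithm as CPB runs it in round `t`. -/
def playCost [NeZero n] (A : CPB n d) (env : Environment n d) (t : ℕ) (ω : A.Outcome env) : ℝ :=
  weitzmanCost A.cost (A.estimate env t ω) (A.value env t ω)

/-- The cost of the extra boxes, those that an oracle requests but Weitzman's algorithm did not
open. With full information all values are revealed for free. -/
def extraCost (A : CPB n d) (env : Environment n d) (t : ℕ) (ω : A.Outcome env) : ℝ :=
  match A.feedback with
  | .fullInformation => 0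
  | .costly => ∑ i ∈ (Finset.univ.filter fun i => A.requested env t ω i = true) \
      weitzmanOpened (A.estimate env t ω) (A.value env t ω), A.cost i

/-- The random variable `∑_{t < T} (playCost_t - WEITZ_{D_t}(σ*_t; c))`: the realized regret without
the cost of the extra boxes. -/
def playRegret [NeZero n] (A : CPB n d) (env : Environment n d) (wstar : Fin n → Vec d) (T : ℕ)
    (ω : A.Outcome env) : ℝ :=
  ∑ t ∈ Finset.range T,
    (A.playCost env t ω - weitz (A.dist env t ω) (A.optimal env wstar t ω) A.cost)

/-- The random variable `∑_{t < T} (playCost_t + extraCost_t - WEITZ_{D_t}(σ*_t; c))`: the realized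
regret of CPB, all opened boxes being paid for. -/
def regret [NeZero n] (A : CPB n d) (env : Environment n d) (wstar : Fin n → Vec d) (T : ℕ)
    (ω : A.Outcome env) : ℝ :=
  ∑ t ∈ Finset.range T, (A.playCost env t ω + A.extraCost env t ω
    - weitz (A.dist env t ω) (A.optimal env wstar t ω) A.cost)

/-- The environments that CPB faces over `T` rounds: allowed by the adversary model, with values in
`Y`, realizable with parameters in `W`, and such that the values and the losses of the optimal
parameters have finite expectations. -/
structure Admissible (A : CPB n d) (env : Environment n d) (am : AdversaryModel)
    (W : Set (Vec d)) (Y : Set ℝ) (wstar : Fin n → Vec d) (T : ℕ) : Prop where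
  respects : env.Respects am
  sample_mem : ∀ t z i u, env.sample t z i u ∈ Y
  wstar_mem : ∀ i, wstar i ∈ W
  realizable : env.Realizable A.h A.cost wstar
  integrable_value : ∀ t < T, ∀ i, Integrable (fun ω => A.value env t ω i) (A.prob env)
  integrable_loss : ∀ t < T, ∀ i, Integrable
    (fun ω => linQuadLoss (A.cost i) (A.optimal env wstar t ω i - A.value env t ω i)) (A.prob env)

end CPB

end

noncomputable section

/-! The cost of wrong reservation values is controlled by the regression loss, in two steps. For a
fixed realization `v`, replace each opening cost by `relu (σ i - v i)`. Weitzman's algorithm with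
`σ` then pays at most `min_j max (σ j) (v j)`, and no nonempty set of opened boxes pays less
(`inf'_add_sum_relu_le_max`, `exists_max_le_inf'_add_sum_relu`). Going back to the true costs leaves
only the errors `c i - relu (σ i - v i)` on the opened boxes. Whether box `i` is opened does not
depend on `v i`, so in expectation the loss against any `τ` is at most `∑ |c i - E relu (σ i - v)|`
(`weitz_sub_le`). The function `a ↦ E H_c(a - v)` is convex with 1-Lipschitz derivative `E relu (a -
v) - c`, which realizability makes vanish at the optimal reservation value. Hence half the squared
error is at most the mean excess loss (`sq_sub_le_integral_linQuadLoss_sub`), and `|e| ≤ η/2 +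
e²/(2η)` makes this linear, ready for summation and expectation. With the seeds of the environment
and of the other oracles and the noise frozen, oracle `i` faces an ordinary adversary of the given
model, so its guarantee integrates over the run (`oracleRegret_integrable_and_le`): expected excess
loss plus request costs is at most `R`. Redrawing the values of one round turns mean excess losses
into realized ones. Altogether the regret is at most `n (T η / 2 + R / η)`. Request costs are
absorbed when `η ≤ 1`, since then they are at most `1/η` times themselves. It remains to choose `η`.
-/

/-! ### ReLU and the linear-quadratic loss. -/

theorem relu_nonneg (z : ℝ) : 0 ≤ relu z := le_max_right _ _

theorem le_relu (z : ℝ) : z ≤ relu z := le_max_left _ _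

theorem relu_of_nonpos {z : ℝ} (hz : z ≤ 0) : relu z = 0 := max_eq_right hz

theorem relu_of_nonneg {z : ℝ} (hz : 0 ≤ z) : relu z = z := max_eq_left hz

@[fun_prop]
theorem measurable_relu : Measurable relu := measurable_id.max measurable_const

@[fun_prop]
theorem measurable_linQuadLoss (c : ℝ) : Measurable (linQuadLoss c) := by
  unfold linQuadLoss
  fun_prop

/-- Since `-c z ≥ -c * relu z`, completing the square suffices. This lower bound is what later makes
excess losses integrable. -/
theorem neg_half_sq_le_linQuadLoss {c : ℝ} (hc : 0 ≤ c) (z : ℝ) :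
    -(c ^ 2 / 2) ≤ linQuadLoss c z := by
  unfold linQuadLoss
  nlinarith [sq_nonneg (relu z - c), mul_nonneg hc (sub_nonneg.2 (le_relu z))]

/-! ### The opening order and the set of opened boxes. -/

/-- Box `l` comes before box `i` in the order in which Weitzman's algorithm opens them. -/
def Precedes {n : ℕ} (σ : Fin n → ℝ) (l i : Fin n) : Prop :=
  σ l < σ i ∨ (σ l = σ i ∧ l < i)

theorem Precedes.le {n : ℕ} {σ : Fin n → ℝ} {l i : Fin n} (h : Precedes σ l i) : σ l ≤ σ i :=
  h.elim le_of_lt fun h => h.1.le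

theorem Precedes.ne {n : ℕ} {σ : Fin n → ℝ} {l i : Fin n} (h : Precedes σ l i) : l ≠ i := by
  rintro rfl
  rcases h with h | h
  · exact lt_irrefl _ h
  · exact lt_irrefl _ h.2

theorem Precedes.trans {n : ℕ} {σ : Fin n → ℝ} {l i j : Fin n} (h : Precedes σ l i)
    (h' : Precedes σ i j) : Precedes σ l j := by
  rcases h with h | h <;> rcases h' with h' | h'
  · exact .inl (h.trans h')
  · exact .inl (h.trans_eq h'.1)
  · exact .inl (h.1.trans_lt h')
  · exact .inr ⟨h.1.trans h'.1, h.2.trans h'.2⟩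

theorem precedes_or {n : ℕ} (σ : Fin n → ℝ) {l i : Fin n} (h : l ≠ i) :
    Precedes σ l i ∨ Precedes σ i l := by
  rcases lt_trichotomy (σ l) (σ i) with h1 | h1 | h1
  · exact .inl (.inl h1)
  · rcases lt_or_gt_of_ne h with h2 | h2
    · exact .inl (.inr ⟨h1, h2⟩)
    · exact .inr (.inr ⟨h1.symm, h2⟩)
  · exact .inr (.inl h1)

theorem sort_symm_lt_iff {n : ℕ} (σ : Fin n → ℝ) (l i : Fin n) :
    (Tuple.sort σ).symm l < (Tuple.sort σ).symm i ↔ Precedes σ l i := by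
  have key : ∀ l i, (Tuple.sort σ).symm l < (Tuple.sort σ).symm i → Precedes σ l i := by
    intro l i hli
    have h1 := Tuple.monotone_sort σ hli.le
    have h2 := ((Tuple.eq_sort_iff (f := σ) (σ := Tuple.sort σ)).1 rfl).2 _ _ hli
    simp only [Function.comp_apply, Equiv.apply_symm_apply] at h1 h2
    rcases h1.lt_or_eq with h | h
    · exact .inl h
    · exact .inr ⟨h, h2 h⟩
  refine ⟨key l i, fun h => ?_⟩
  by_contra h'
  rcases (not_lt.1 h').lt_or_eq with h2 | h2
  · exact (h.trans (key _ _ h2)).ne rfl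
  · exact h.ne ((Tuple.sort σ).symm.injective h2.symm)

/-- Box `i` is opened iff no box opened before it contains a value below its reservation value. -/
theorem mem_weitzmanOpened_iff {n : ℕ} (σ v : Fin n → ℝ) (i : Fin n) :
    i ∈ weitzmanOpened σ v ↔ ∀ l, Precedes σ l i → σ i ≤ v l := by
  simp only [weitzmanOpened, Finset.mem_filter, Finset.mem_univ, true_and]
  simp only [weitzmanStopsAfter]
  constructor
  · intro H l hl
    have hl' := (sort_symm_lt_iff σ l i).2 hl
    by_contra hlt
    have hpos : 0 < ((Tuple.sort σ).symm i : ℕ) := (Nat.zero_le _).trans_lt hl'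
    -- The position just before `i`: there the next reservation value is `σ i` itself.
    refine H (((Tuple.sort σ).symm i : ℕ) - 1) (by omega)
      ⟨by omega, (Tuple.sort σ).symm l, by have : (_ : ℕ) < _ := hl'; omega, ?_⟩
    have e : (⟨((Tuple.sort σ).symm i : ℕ) - 1 + 1, by omega⟩ : Fin n) = (Tuple.sort σ).symm i :=
      Fin.ext (by simp only; omega)
    rw [e]
    simpa using hlt
  · rintro H k hk ⟨hk1, l, hlk, hlt⟩
    have h1 : Precedes σ (Tuple.sort σ l) i := by
      rw [← sort_symm_lt_iff, Equiv.symm_apply_apply]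
      exact hlk.trans_lt hk
    have h2 : σ (Tuple.sort σ ⟨k + 1, hk1⟩) ≤ σ i := by
      have := Tuple.monotone_sort σ (show (⟨k + 1, hk1⟩ : Fin n) ≤ (Tuple.sort σ).symm i from hk)
      simpa using this
    linarith [H _ h1]

/-! ### Pointwise optimality of Weitzman's algorithm. -/

/-- At most one opened box has a value below its reservation value, because the algorithm stops
after it; so the sum has at most one nonzero term, and that term raises the cost to at most `σ i`.
-/
theorem inf'_add_sum_relu_le_max {n : ℕ} [NeZero n] (σ v : Fin n → ℝ) (j : Fin n) :
    (weitzmanOpened σ v).inf' (weitzmanOpened_nonempty σ v) v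
      + ∑ i ∈ weitzmanOpened σ v, relu (σ i - v i) ≤ max (σ j) (v j) := by
  by_cases hA : ∃ i ∈ weitzmanOpened σ v, v i < σ i
  · obtain ⟨i, hi, hlt⟩ := hA
    have hi' := (mem_weitzmanOpened_iff σ v i).1 hi
    -- Box `i` is the last one opened, and the values found before it are at least `σ i`.
    have hsum : ∑ l ∈ weitzmanOpened σ v, relu (σ l - v l) = relu (σ i - v i) := by
      refine Finset.sum_eq_single_of_mem i hi fun l hl hne => ?_
      rcases precedes_or σ hne with h | h
      · exact relu_of_nonpos (by linarith [hi' l h, h.le])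
      · linarith [(mem_weitzmanOpened_iff σ v l).1 hl i h, h.le]
    rw [hsum, relu_of_nonneg (by linarith)]
    have h1 : (weitzmanOpened σ v).inf' (weitzmanOpened_nonempty σ v) v ≤ v i :=
      Finset.inf'_le _ hi
    have h2 : σ i ≤ max (σ j) (v j) := by
      by_cases hij : i = j
      · exact hij ▸ le_max_left _ _
      · rcases precedes_or σ hij with h | h
        · exact h.le.trans (le_max_left _ _)
        · exact (hi' j h).trans (le_max_right _ _)
    linarith
  · push Not at hA
    rw [Finset.sum_eq_zero fun i hi => relu_of_nonpos (by linarith [hA i hi]), add_zero]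
    by_cases hj : j ∈ weitzmanOpened σ v
    · exact (Finset.inf'_le _ hj).trans (le_max_right _ _)
    -- Take the earliest box that blocks `j`. It is opened, since a box blocking it would block `j`
    -- earlier.
    · obtain ⟨l, ⟨hl, hlt⟩, hmin⟩ : ∃ l, (Precedes σ l j ∧ v l < σ j) ∧
          ∀ l', Precedes σ l' j ∧ v l' < σ j →
            (Tuple.sort σ).symm l ≤ (Tuple.sort σ).symm l' := by
        classical
        rw [mem_weitzmanOpened_iff] at hj
        push Not at hj
        obtain ⟨l₀, hl₀⟩ := hj
        obtain ⟨l, hl, hm⟩ := Finset.exists_min_image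
          (Finset.univ.filter fun l => Precedes σ l j ∧ v l < σ j) (Tuple.sort σ).symm
          ⟨l₀, by simpa using hl₀⟩
        exact ⟨l, by simpa using hl, fun l' hl' => hm l' (by simpa using hl')⟩
      have hop : l ∈ weitzmanOpened σ v := by
        rw [mem_weitzmanOpened_iff]
        intro l' hl'
        by_contra hc
        exact absurd ((sort_symm_lt_iff σ l' l).2 hl')
          (not_lt.2 (hmin l' ⟨hl'.trans hl, (not_le.1 hc).trans_le hl.le⟩))
      exact ((Finset.inf'_le _ hop).trans hlt.le).trans (le_max_left _ _)

/-- The box `j` attaining the minimum works: its own term already lifts `v j` to `max (σ j) (v j)`.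
The set may be chosen with knowledge of all values, so any competitor is covered. -/
theorem exists_max_le_inf'_add_sum_relu {n : ℕ} (σ v : Fin n → ℝ) (s : Finset (Fin n))
    (hs : s.Nonempty) :
    ∃ j, max (σ j) (v j) ≤ s.inf' hs v + ∑ i ∈ s, relu (σ i - v i) := by
  obtain ⟨j, hj, he⟩ := Finset.exists_mem_eq_inf' hs v
  refine ⟨j, ?_⟩
  have h1 : relu (σ j - v j) ≤ ∑ i ∈ s, relu (σ i - v i) :=
    Finset.single_le_sum (f := fun i => relu (σ i - v i)) (fun i _ => relu_nonneg _) hj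
  rw [he]
  exact max_le (by linarith [le_relu (σ j - v j)]) (by linarith [relu_nonneg (σ j - v j)])

/-- Weitzman's algorithm with reservation values `σ` is optimal for the (random) opening costs
`ReLU(σ i - v i)`. -/
theorem weitzmanCost_sub_le {n : ℕ} [NeZero n] (c σ τ v : Fin n → ℝ) :
    weitzmanCost c σ v - weitzmanCost c τ v ≤
      ∑ i ∈ weitzmanOpened σ v, (c i - relu (σ i - v i))
        - ∑ i ∈ weitzmanOpened τ v, (c i - relu (σ i - v i)) := by
  obtain ⟨j, hj⟩ := exists_max_le_inf'_add_sum_relu σ v _ (weitzmanOpened_nonempty τ v)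
  have h := inf'_add_sum_relu_le_max σ v j
  simp only [weitzmanCost, Finset.sum_sub_distrib]
  linarith

/-! ### Bounds and measurability of the cost. -/

theorem abs_weitzmanCost_le {n : ℕ} [NeZero n] (c σ v : Fin n → ℝ) :
    |weitzmanCost c σ v| ≤ ∑ i, |v i| + ∑ i, |c i| := by
  unfold weitzmanCost
  obtain ⟨j, hj, he⟩ := Finset.exists_mem_eq_inf' (weitzmanOpened_nonempty σ v) v
  rw [he]
  refine (abs_add_le _ _).trans (add_le_add ?_ ?_)
  · exact Finset.single_le_sum (f := fun i => |v i|) (fun i _ => abs_nonneg _) (Finset.mem_univ j)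
  · exact (Finset.abs_sum_le_sum_abs _ _).trans
      (Finset.sum_le_sum_of_subset_of_nonneg (Finset.subset_univ _) fun i _ _ => abs_nonneg _)

theorem measurableSet_mem_weitzmanOpened {n : ℕ} (i : Fin n) :
    MeasurableSet {p : (Fin n → ℝ) × (Fin n → ℝ) | i ∈ weitzmanOpened p.1 p.2} := by
  simp only [mem_weitzmanOpened_iff, Precedes]
  have : ∀ k : Fin n, Measurable fun p : (Fin n → ℝ) × (Fin n → ℝ) => p.1 k := by fun_prop
  have : ∀ k : Fin n, Measurable fun p : (Fin n → ℝ) × (Fin n → ℝ) => p.2 k := by fun_prop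
  measurability

theorem measurableSet_weitzmanOpened_eq {n : ℕ} (s : Finset (Fin n)) :
    MeasurableSet {p : (Fin n → ℝ) × (Fin n → ℝ) | weitzmanOpened p.1 p.2 = s} := by
  have : {p : (Fin n → ℝ) × (Fin n → ℝ) | weitzmanOpened p.1 p.2 = s} =
      ⋂ i, {p | i ∈ weitzmanOpened p.1 p.2 ↔ i ∈ s} := by
    ext p
    simp [Finset.ext_iff]
  rw [this]
  exact MeasurableSet.iInter fun i =>
    (measurableSet_mem_weitzmanOpened i).iff (MeasurableSet.const _)

theorem measurable_weitzmanCost {n : ℕ} [NeZero n] (c : Fin n → ℝ) :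
    Measurable fun p : (Fin n → ℝ) × (Fin n → ℝ) => weitzmanCost c p.1 p.2 := by
  classical
  -- Split according to the opened set. The default `0` at the empty set is never used.
  have h : (fun p : (Fin n → ℝ) × (Fin n → ℝ) => weitzmanCost c p.1 p.2) = fun p =>
      ∑ s : Finset (Fin n), if weitzmanOpened p.1 p.2 = s then
        (if hs : s.Nonempty then s.inf' hs p.2 + ∑ i ∈ s, c i else 0) else 0 := by
    ext p
    simp [weitzmanCost, weitzmanOpened_nonempty]
  rw [h]
  refine Finset.measurable_sum _ fun s _ =>
    Measurable.ite (measurableSet_weitzmanOpened_eq s) ?_ measurable_const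
  by_cases hs : s.Nonempty
  · simp only [hs, dif_pos]
    refine Measurable.add_const ?_ _
    have e : (fun p : (Fin n → ℝ) × (Fin n → ℝ) => s.inf' hs p.2) =
        s.inf' hs fun i p => p.2 i := by
      ext p
      rw [Finset.inf'_apply]
    rw [e]
    exact Finset.inf'_induction hs (fun i (p : (Fin n → ℝ) × (Fin n → ℝ)) => p.2 i)
      (fun f hf g hg => hf.inf hg) fun i _ => by fun_prop
  · simp [hs]

theorem Measurable.weitzmanCost {n : ℕ} [NeZero n] {α : Type*} [MeasurableSpace α]
    {σ v : α → Fin n → ℝ} (hσ : Measurable σ) (c : Fin n → ℝ) (hv : Measurable v) :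
    Measurable fun a => _root_.weitzmanCost c (σ a) (v a) := by
  have h := hσ.prodMk hv
  have h' := (measurable_weitzmanCost c).comp h
  exact h'

/-! ### Resampling some of the coordinates of a product measure -/

/-- Serves twice: for the independence of a box's value from the decision to open it, and for giving
one oracle a fresh seed. -/
theorem measurePreserving_update {ι : Type*} [Fintype ι] [DecidableEq ι] {X : ι → Type*}
    [∀ i, MeasurableSpace (X i)] (μ : ∀ i, Measure (X i)) [∀ i, IsProbabilityMeasure (μ i)]
    (i : ι) :
    MeasurePreserving (fun p : (∀ i, X i) × X i => Function.update p.1 i p.2)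
      ((Measure.pi μ).prod (μ i)) (Measure.pi μ) := by
  have hm : Measurable fun p : (∀ i, X i) × X i => Function.update p.1 i p.2 := measurable_update'
  refine ⟨hm, (Measure.pi_eq fun s hs => ?_).symm⟩
  rw [Measure.map_apply hm (MeasurableSet.univ_pi hs)]
  have : (fun p : (∀ i, X i) × X i => Function.update p.1 i p.2) ⁻¹' Set.univ.pi s =
      (Set.univ.pi (Function.update s i Set.univ)) ×ˢ s i := by
    ext p
    simp only [Set.mem_preimage, Set.mem_univ_pi, Set.mem_prod]
    constructor
    · intro h
      refine ⟨fun j => ?_, by simpa using h i⟩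
      by_cases hj : j = i
      · subst hj; simp
      · simpa [hj] using h j
    · rintro ⟨h1, h2⟩ j
      by_cases hj : j = i
      · subst hj; simpa using h2
      · simpa [hj] using h1 j
  rw [this, Measure.prod_prod, Measure.pi_pi, ← Finset.mul_prod_erase _ _ (Finset.mem_univ i),
    ← Finset.mul_prod_erase (Finset.univ) (fun j => μ j (s j)) (Finset.mem_univ i)]
  simp only [Function.update_self, measure_univ, one_mul]
  rw [mul_comm]
  congr 1
  exact Finset.prod_congr rfl fun j hj => by rw [Function.update_of_ne (Finset.ne_of_mem_erase hj)]

/-- The preimage of a finite cylinder is a product of two cylinders, over the coordinates kept and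
those redrawn. With `P` selecting one round, this redraws the values of that round. -/
theorem measurePreserving_ite_infinitePi {ι : Type*} {X : ι → Type*}
    [∀ i, MeasurableSpace (X i)] (μ : ∀ i, Measure (X i)) [∀ i, IsProbabilityMeasure (μ i)]
    (P : ι → Prop) [DecidablePred P] :
    MeasurePreserving (fun (p : (∀ i, X i) × (∀ i, X i)) i => if P i then p.2 i else p.1 i)
      ((Measure.infinitePi μ).prod (Measure.infinitePi μ)) (Measure.infinitePi μ) := by
  have hm : Measurable fun (p : (∀ i, X i) × (∀ i, X i)) i =>
      if P i then p.2 i else p.1 i := by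
    refine measurable_pi_iff.2 fun i => ?_
    by_cases hi : P i
    · simp only [hi, if_true]
      fun_prop
    · simp only [hi, if_false]
      fun_prop
  refine ⟨hm, Measure.eq_infinitePi μ fun s t ht => ?_⟩
  rw [Measure.map_apply hm (MeasurableSet.pi s.countable_toSet fun i _ => ht i)]
  have : (fun (p : (∀ i, X i) × (∀ i, X i)) i => if P i then p.2 i else p.1 i) ⁻¹'
      (s : Set ι).pi t = ((s.filter fun i => ¬ P i : Finset ι) : Set ι).pi t ×ˢ
        ((s.filter P : Finset ι) : Set ι).pi t := by
    ext p
    simp only [Set.mem_preimage, Set.mem_pi, Set.mem_prod, Finset.coe_filter, Set.mem_ofPred_eq,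
      Finset.mem_coe]
    constructor
    · intro h
      exact ⟨fun i hi => by simpa [hi.2] using h i hi.1, fun i hi => by simpa [hi.2] using h i hi.1⟩
    · rintro ⟨h1, h2⟩ i hi
      by_cases hS : P i
      · simpa [hS] using h2 i ⟨hi, hS⟩
      · simpa [hS] using h1 i ⟨hi, hS⟩
  rw [this, Measure.prod_prod, Measure.infinitePi_pi μ fun i _ => ht i,
    Measure.infinitePi_pi μ fun i _ => ht i, mul_comm,
    Finset.prod_filter_mul_prod_filter_not]

theorem MeasureTheory.MeasurePreserving.integral_comp_of_aestronglyMeasurable {α β : Type*}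
    [MeasurableSpace α] [MeasurableSpace β] {μ : Measure α} {ν : Measure β} {φ : α → β}
    (hφ : MeasurePreserving φ μ ν) {f : β → ℝ} (hf : AEStronglyMeasurable f ν) :
    ∫ x, f (φ x) ∂μ = ∫ y, f y ∂ν := by
  rw [← hφ.map_eq] at hf ⊢
  exact (integral_map hφ.measurable.aemeasurable hf).symm

/-- A function that does not depend on the coordinate `i` is independent of that coordinate. -/
theorem integral_mul_eval_of_update_eq {ι : Type*} [Fintype ι] [DecidableEq ι] {X : ι → Type*}
    [∀ i, MeasurableSpace (X i)] (μ : ∀ i, Measure (X i)) [∀ i, IsProbabilityMeasure (μ i)]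
    (i : ι) {f : (∀ i, X i) → ℝ} {g : X i → ℝ} (hf : Measurable f) (hg : Measurable g)
    (hfi : ∀ v x, f (Function.update v i x) = f v) :
    ∫ v, f v * g (v i) ∂(Measure.pi μ) = (∫ v, f v ∂(Measure.pi μ)) * ∫ x, g x ∂(μ i) := by
  have hm : Measurable fun v => f v * g (v i) := hf.mul (hg.comp (measurable_pi_apply i))
  rw [← (measurePreserving_update μ i).integral_comp_of_aestronglyMeasurable
    hm.aestronglyMeasurable]
  simp only [hfi, Function.update_self]
  exact integral_prod_mul f g

/-! ### The cost of wrong reservation values -/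

theorem integrable_relu_sub {D : Measure ℝ} [IsProbabilityMeasure D]
    (hD : Integrable (fun v => v) D) (a : ℝ) : Integrable (fun v => relu (a - v)) D :=
  ((integrable_const a).sub hD).pos_part

theorem integrable_weitzmanCost {n : ℕ} [NeZero n] (D : Fin n → Measure ℝ)
    [∀ i, IsProbabilityMeasure (D i)] (hD : ∀ i, Integrable (fun v => v) (D i))
    (c σ : Fin n → ℝ) : Integrable (weitzmanCost c σ) (Measure.pi D) := by
  refine Integrable.mono' (g := fun v => ∑ i, |v i| + ∑ i, |c i|) ?_
    (measurable_const.weitzmanCost c measurable_id').aestronglyMeasurable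
    (Eventually.of_forall fun v => abs_weitzmanCost_le c σ v)
  refine (integrable_finsetSum _ fun i _ => ?_).add (integrable_const _)
  exact ((measurePreserving_eval D i).integrable_comp_of_integrable (hD i)).abs

theorem weitzmanOpened_update {n : ℕ} (σ v : Fin n → ℝ) (i : Fin n) (x : ℝ) :
    i ∈ weitzmanOpened σ (Function.update v i x) ↔ i ∈ weitzmanOpened σ v := by
  simp only [mem_weitzmanOpened_iff]
  exact forall₂_congr fun l hl => by rw [Function.update_of_ne hl.ne]

/-- Using the reservation values `σ` instead of `τ` costs at most the total error of the opening
costs for which `σ` is optimal. -/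
theorem weitz_sub_le {n : ℕ} [NeZero n] (D : Fin n → Measure ℝ)
    [∀ i, IsProbabilityMeasure (D i)] (hD : ∀ i, Integrable (fun v => v) (D i))
    (c σ τ : Fin n → ℝ) :
    weitz D σ c - weitz D τ c ≤ ∑ i, |c i - ∫ v, relu (σ i - v) ∂(D i)| := by
  classical
  let f : Fin n → (Fin n → ℝ) → ℝ := fun i v =>
    (if i ∈ weitzmanOpened σ v then 1 else 0) - (if i ∈ weitzmanOpened τ v then 1 else 0)
  let g : Fin n → ℝ → ℝ := fun i x => c i - relu (σ i - x)
  have hs : ∀ (ρ : Fin n → ℝ) i, MeasurableSet {v | i ∈ weitzmanOpened ρ v} := fun ρ i =>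
    (measurable_const.prodMk measurable_id : Measurable fun v : Fin n → ℝ => (ρ, v))
      (measurableSet_mem_weitzmanOpened i)
  have hfm : ∀ i, Measurable (f i) := fun i =>
    (Measurable.ite (hs σ i) measurable_const measurable_const).sub
      (Measurable.ite (hs τ i) measurable_const measurable_const)
  have hf1 : ∀ i v, ‖f i v‖ ≤ 1 := by
    intro i v
    simp only [f]
    split_ifs <;> simp
  have hgm : ∀ i, Measurable (g i) := fun i => by fun_prop
  have hgi : ∀ i, Integrable (g i) (D i) := fun i =>
    (integrable_const _).sub (integrable_relu_sub (hD i) _)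
  have hge : ∀ i, Integrable (fun v : Fin n → ℝ => g i (v i)) (Measure.pi D) := fun i =>
    (measurePreserving_eval D i).integrable_comp_of_integrable (hgi i)
  have hfg : ∀ i, Integrable (fun v => f i v * g i (v i)) (Measure.pi D) := fun i =>
    (hge i).bdd_mul (hfm i).aestronglyMeasurable (Eventually.of_forall (hf1 i))
  unfold weitz
  rw [← integral_sub (integrable_weitzmanCost D hD c σ) (integrable_weitzmanCost D hD c τ)]
  calc ∫ v, (weitzmanCost c σ v - weitzmanCost c τ v) ∂(Measure.pi D)
      -- Here `f i` compares the two opening decisions and `g i` is the error of the opening cost.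
      ≤ ∫ v, ∑ i, f i v * g i (v i) ∂(Measure.pi D) := by
        refine integral_mono ((integrable_weitzmanCost D hD c σ).sub
          (integrable_weitzmanCost D hD c τ)) (integrable_finsetSum _ fun i _ => hfg i)
          fun v => (weitzmanCost_sub_le c σ τ v).trans_eq ?_
        simp only [f, g, sub_mul, ite_mul, one_mul, zero_mul, Finset.sum_sub_distrib,
          Finset.sum_ite_mem, Finset.univ_inter]
    _ = ∑ i, (∫ v, f i v ∂(Measure.pi D)) * (c i - ∫ v, relu (σ i - v) ∂(D i)) := by
        rw [integral_finsetSum _ fun i _ => hfg i]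
        refine Finset.sum_congr rfl fun i _ => ?_
        -- Both opening decisions ignore `v i`, so the integral factors.
        rw [integral_mul_eval_of_update_eq D i (hfm i) (hgm i) fun v x => by
          simp only [f, weitzmanOpened_update]]
        simp only [g]
        rw [integral_sub (integrable_const _) (integrable_relu_sub (hD i) _)]
        simp
    _ ≤ ∑ i, |c i - ∫ v, relu (σ i - v) ∂(D i)| := by
        refine Finset.sum_le_sum fun i _ => (le_abs_self _).trans ?_
        rw [abs_mul]
        refine mul_le_of_le_one_left (abs_nonneg _) ?_
        have := norm_integral_le_of_norm_le_const (μ := Measure.pi D)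
          (Eventually.of_forall (hf1 i))
        simpa using this

/-! ### The linear-quadratic loss controls the error of the opening cost -/

/-- First moments suffice although the loss is quadratic: in the difference of squares one factor is
bounded by `|a - b|`. -/
theorem integrable_linQuadLoss_sub {D : Measure ℝ} [IsProbabilityMeasure D]
    (hD : Integrable (fun v => v) D) (c a b : ℝ) :
    Integrable (fun v => linQuadLoss c (a - v) - linQuadLoss c (b - v)) D := by
  have h : (fun v => linQuadLoss c (a - v) - linQuadLoss c (b - v)) = fun v =>
      (relu (a - v) - relu (b - v)) * (1 / 2 * (relu (a - v) + relu (b - v))) - c * (a - b) := by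
    ext v
    unfold linQuadLoss
    ring
  rw [h]
  refine Integrable.sub ?_ (integrable_const _)
  refine Integrable.bdd_mul (c := |a - b|) (((integrable_relu_sub hD a).add
    (integrable_relu_sub hD b)).const_mul _) (by fun_prop) (Eventually.of_forall fun v => ?_)
  have := abs_max_sub_max_le_abs (a - v) (b - v) 0
  rwa [sub_sub_sub_cancel_right] at this

/-- With `A = relu (a - v)` and `B = relu (b - v)`, `(A² - B²)/2 = B (A - B) + (A - B)²/2`. The
first term is at least `B (a - b)`, the second at least `m (A - B) - m²/2` for every constant `m`.
Integrating with `m = E A - c` and `E B = c` leaves `m²/2`. -/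
theorem sq_sub_le_integral_linQuadLoss_sub {D : Measure ℝ} [IsProbabilityMeasure D]
    (hD : Integrable (fun v => v) D) {c b : ℝ} (hb : ∫ v, relu (b - v) ∂D = c) (a : ℝ) :
    (c - ∫ v, relu (a - v) ∂D) ^ 2 / 2
      ≤ ∫ v, (linQuadLoss c (a - v) - linQuadLoss c (b - v)) ∂D := by
  set m := ∫ v, relu (a - v) ∂D - c with hm
  have ha := integrable_relu_sub hD a
  have hb' := integrable_relu_sub hD b
  have hle : ∫ v, ((a - b - m) * relu (b - v) + m * relu (a - v) - (m ^ 2 / 2 + c * (a - b))) ∂D ≤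
      ∫ v, (linQuadLoss c (a - v) - linQuadLoss c (b - v)) ∂D := by
    refine integral_mono (((hb'.const_mul _).add (ha.const_mul _)).sub (integrable_const _))
      (integrable_linQuadLoss_sub hD c a b) fun v => ?_
    have h1 : 0 ≤ relu (b - v) * (relu (a - v) - relu (b - v) - (a - b)) := by
      rcases le_total (b - v) 0 with h | h
      · simp [relu_of_nonpos h]
      · refine mul_nonneg (relu_nonneg _) ?_
        rw [relu_of_nonneg h]
        linarith [le_relu (a - v)]
    simp only [linQuadLoss]
    nlinarith [sq_nonneg (relu (a - v) - relu (b - v) - m)]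
  have hi : Integrable (fun v => (a - b - m) * relu (b - v) + m * relu (a - v)) D :=
    (hb'.const_mul _).add (ha.const_mul _)
  rw [integral_sub hi (integrable_const _),
    integral_add (hb'.const_mul _) (ha.const_mul _), integral_const_mul, integral_const_mul,
    hb] at hle
  simp only [integral_const, probReal_univ, one_smul] at hle
  have h2 : ∫ v, relu (a - v) ∂D = m + c := by rw [hm]; ring
  rw [h2] at hle ⊢
  linarith

/-- The inequality `x ≤ η/2 + x²/(2η)` replaces a square root by a bound linear in the excess loss.
-/
theorem abs_sub_integral_relu_le {D : Measure ℝ} [IsProbabilityMeasure D]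
    (hD : Integrable (fun v => v) D) {c b : ℝ} (hb : ∫ v, relu (b - v) ∂D = c) (a : ℝ) {η : ℝ}
    (hη : 0 < η) :
    |c - ∫ v, relu (a - v) ∂D|
      ≤ η / 2 + η⁻¹ * ∫ v, (linQuadLoss c (a - v) - linQuadLoss c (b - v)) ∂D := by
  have h := mul_le_mul_of_nonneg_left (sq_sub_le_integral_linQuadLoss_sub hD hb a)
    (inv_nonneg.2 hη.le)
  refine le_trans ?_ (add_le_add_right h _)
  rw [← sq_abs]
  have : η / 2 + η⁻¹ * (|c - ∫ v, relu (a - v) ∂D| ^ 2 / 2) - |c - ∫ v, relu (a - v) ∂D| =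
      η⁻¹ * (η - |c - ∫ v, relu (a - v) ∂D|) ^ 2 / 2 := by
    field_simp
    ring
  have h2 : 0 ≤ η⁻¹ * (η - |c - ∫ v, relu (a - v) ∂D|) ^ 2 / 2 := by positivity
  linarith

/-! ### Joint integrability -/

/-- A measurable function with an integrable lower bound is integrable if the integrals of its
sections are bounded. -/
theorem integrable_prod_of_forall_section_le {α β : Type*} [MeasurableSpace α]
    [MeasurableSpace β] {μ : Measure α} {ν : Measure β} [IsProbabilityMeasure μ] [SFinite ν]
    {f g : α × β → ℝ} {R : ℝ} (hf : Measurable f) (hg : Integrable g (μ.prod ν))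
    (hle : ∀ p, -g p ≤ f p) (hfs : ∀ x, Integrable (fun y => f (x, y)) ν)
    (hR : ∀ x, ∫ y, f (x, y) ∂ν ≤ R) :
    Integrable f (μ.prod ν) ∧ ∫ p, f p ∂(μ.prod ν) ≤ R := by
  have hint : Integrable f (μ.prod ν) := by
    rw [integrable_prod_iff hf.aestronglyMeasurable]
    refine ⟨Eventually.of_forall hfs, ?_⟩
    -- The lower bound `-g ≤ f` gives `|f| ≤ f + 2|g|`, so the bound on the section integrals of `f`
    -- also controls those of `|f|`.
    refine Integrable.mono' (g := fun x => R + 2 * ∫ y, |g (x, y)| ∂ν)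
      ((integrable_const R).add (hg.abs.integral_prod_left.const_mul 2))
      hf.norm.stronglyMeasurable.integral_prod_right'.aestronglyMeasurable ?_
    filter_upwards [hg.prod_right_ae] with x hx
    rw [Real.norm_of_nonneg (integral_nonneg fun y => norm_nonneg _)]
    calc ∫ y, ‖f (x, y)‖ ∂ν ≤ ∫ y, (f (x, y) + 2 * |g (x, y)|) ∂ν := by
          refine integral_mono (hfs x).norm ((hfs x).add (hx.abs.const_mul 2)) fun y => ?_
          have h1 := hle (x, y)
          have h2 := le_abs_self (g (x, y))
          exact abs_le.2 ⟨by linarith, by linarith [abs_nonneg (g (x, y))]⟩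
      _ ≤ R + 2 * ∫ y, |g (x, y)| ∂ν := by
          rw [integral_add (hfs x) (hx.abs.const_mul 2), integral_const_mul]
          linarith [hR x]
  refine ⟨hint, ?_⟩
  rw [integral_prod _ hint]
  calc _ ≤ ∫ _, R ∂μ := integral_mono hint.integral_prod_left (integrable_const R) hR
    _ = R := by simp

/-! ### Measurability of the run -/

theorem measurable_snoc {α β : Type*} [MeasurableSpace α] [MeasurableSpace β] {t : ℕ}
    {f : α → Fin t → β} {g : α → β} (hf : Measurable f) (hg : Measurable g) :
    Measurable fun a => Fin.snoc (α := fun _ => β) (f a) (g a) := by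
  refine measurable_pi_iff.2 fun j => ?_
  refine Fin.lastCases ?_ (fun j => ?_) j
  · simpa using hg
  · simpa [Function.comp_def] using (measurable_pi_apply j).comp hf

theorem measurable_observe {d : ℕ} (fm : FeedbackModel) :
    Measurable (observe fm : Round d → Observation d) := by
  cases fm with
  | fullInformation => exact measurable_inr.comp measurable_snd
  | costly =>
    refine Measurable.ite ?_ (measurable_inr.comp measurable_snd) measurable_const
    exact (measurable_snd.comp measurable_fst : Measurable fun ρ : Round d => ρ.1.2)
      (measurableSet_singleton true)

theorem Oracle.measurable_act {d : ℕ} (O : Oracle d) (fm : FeedbackModel) (t : ℕ) :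
    Measurable fun p : O.Seed × (Fin t → Round d) => O.act fm t p.1 p.2 := by
  have h : Measurable fun p : O.Seed × (Fin t → Round d) =>
      (p.1, fun j => observe fm (p.2 j)) :=
    measurable_fst.prodMk (measurable_pi_iff.2 fun j =>
      (measurable_observe fm).comp ((measurable_pi_apply j).comp measurable_snd))
  exact ((O.measurable_predict t).comp h).prodMk ((O.measurable_request t).comp h)

namespace CPB

variable {n d : ℕ}

theorem measurable_act (A : CPB n d) (env : Environment n d) (t : ℕ) :
    Measurable fun p : A.Outcome env × (Fin t → Fin n → Round d) => A.act p.1 t p.2 := by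
  refine measurable_pi_iff.2 fun i => ?_
  have h : Measurable fun p : A.Outcome env × (Fin t → Fin n → Round d) =>
      (p.1.2.2 i, fun j => p.2 j i) :=
    ((measurable_pi_apply i).comp (measurable_snd.comp (measurable_snd.comp
      measurable_fst))).prodMk (measurable_pi_iff.2 fun j =>
        (measurable_pi_apply i).comp ((measurable_pi_apply j).comp measurable_snd))
  exact ((A.oracle i).measurable_act A.feedback t).comp h

theorem measurable_transcript (A : CPB n d) (env : Environment n d) (t : ℕ) :
    Measurable fun ω => A.transcript env ω t := by
  induction t with
  | zero => exact measurable_pi_iff.2 fun j => j.elim0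
  | succ t ih =>
    have ha : Measurable fun ω : A.Outcome env => A.act ω t (A.transcript env ω t) :=
      (A.measurable_act env t).comp (measurable_id.prodMk ih)
    have hz : Measurable fun ω : A.Outcome env =>
        ((ω.1, A.transcript env ω t, fun i => (A.act ω t (A.transcript env ω t) i).1) :
          env.Seed × History n d t) :=
      measurable_fst.prodMk (ih.prodMk (measurable_pi_iff.2 fun i =>
        measurable_fst.comp ((measurable_pi_apply i).comp ha)))
    refine measurable_snoc ih (measurable_pi_iff.2 fun i => ?_)
    refine ((measurable_pi_apply i).comp ha).prodMk
      (((env.measurable_context t i).comp hz).prodMk ((env.measurable_sample t i).comp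
        (hz.prodMk ?_)))
    exact (measurable_pi_apply (t, i)).comp (measurable_fst.comp measurable_snd)

theorem measurable_act_transcript (A : CPB n d) (env : Environment n d) (t : ℕ) :
    Measurable fun ω : A.Outcome env => A.act ω t (A.transcript env ω t) :=
  (A.measurable_act env t).comp (measurable_id.prodMk (A.measurable_transcript env t))

theorem measurable_prediction (A : CPB n d) (env : Environment n d) (t : ℕ) (i : Fin n) :
    Measurable fun ω => A.prediction env t ω i :=
  measurable_fst.comp ((measurable_pi_apply i).comp (A.measurable_act_transcript env t))

theorem measurable_requested (A : CPB n d) (env : Environment n d) (t : ℕ) (i : Fin n) :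
    Measurable fun ω => A.requested env t ω i :=
  measurable_snd.comp ((measurable_pi_apply i).comp (A.measurable_act_transcript env t))

theorem measurable_state (A : CPB n d) (env : Environment n d) (t : ℕ) :
    Measurable (A.state env t) :=
  measurable_fst.prodMk ((A.measurable_transcript env t).prodMk
    (measurable_pi_iff.2 fun i => A.measurable_prediction env t i))

theorem measurable_context (A : CPB n d) (env : Environment n d) (t : ℕ) (i : Fin n) :
    Measurable fun ω => A.context env t ω i :=
  (env.measurable_context t i).comp (A.measurable_state env t)

theorem measurable_value (A : CPB n d) (env : Environment n d) (t : ℕ) (i : Fin n) :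
    Measurable fun ω => A.value env t ω i :=
  (env.measurable_sample t i).comp ((A.measurable_state env t).prodMk
    ((measurable_pi_apply (t, i)).comp (measurable_fst.comp measurable_snd)))

theorem measurable_estimate (A : CPB n d) (env : Environment n d)
    (hh : Measurable fun p : Vec d × Vec d => A.h p.1 p.2) (t : ℕ) (i : Fin n) :
    Measurable fun ω => A.estimate env t ω i :=
  hh.comp ((A.measurable_prediction env t i).prodMk (A.measurable_context env t i))

theorem measurable_optimal (A : CPB n d) (env : Environment n d)
    (hh : Measurable fun p : Vec d × Vec d => A.h p.1 p.2) (wstar : Fin n → Vec d) (t : ℕ)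
    (i : Fin n) : Measurable fun ω => A.optimal env wstar t ω i :=
  hh.comp (measurable_const.prodMk (A.measurable_context env t i))

/-! ### The adversary that the oracle of a single box faces -/

/-- The first `t` rounds of the run in which the moves of the oracle of box `i` are replaced by
given ones. -/
def simulate (A : CPB n d) (env : Environment n d) (ω : A.Outcome env) (i : Fin n) :
    (t : ℕ) → (Fin t → Move d) → Fin t → Fin n → Round d
  | 0, _ => fun j => j.elim0
  | t + 1, m =>
    let past := A.simulate env ω i t fun j => m j.castSucc
    let a := Function.update (A.act ω t past) i (m (Fin.last t))
    let z : env.Seed × History n d t := (ω.1, past, fun k => (a k).1)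
    Fin.snoc (α := fun _ => Fin n → Round d) past fun k =>
      (a k, env.context t z k, env.sample t z k (ω.2.1 (t, k)))

theorem measurable_simulate (A : CPB n d) (env : Environment n d) (ω : A.Outcome env)
    (i : Fin n) (t : ℕ) : Measurable (A.simulate env ω i t) := by
  induction t with
  | zero => exact measurable_pi_iff.2 fun j => j.elim0
  | succ t ih =>
    have hp : Measurable fun m : Fin (t + 1) → Move d =>
        A.simulate env ω i t fun j => m j.castSucc :=
      ih.comp (measurable_pi_iff.2 fun j => measurable_pi_apply _)
    have ha : Measurable fun m : Fin (t + 1) → Move d =>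
        Function.update (A.act ω t (A.simulate env ω i t fun j => m j.castSucc)) i
          (m (Fin.last t)) :=
      measurable_update'.comp
        (((A.measurable_act env t).comp (measurable_const.prodMk hp)).prodMk
          (measurable_pi_apply _))
    have hz : Measurable fun m : Fin (t + 1) → Move d =>
        ((ω.1, A.simulate env ω i t fun j => m j.castSucc, fun k =>
          (Function.update (A.act ω t (A.simulate env ω i t fun j => m j.castSucc)) i
            (m (Fin.last t)) k).1) : env.Seed × History n d t) :=
      measurable_const.prodMk (hp.prodMk (measurable_pi_iff.2 fun k =>
        measurable_fst.comp ((measurable_pi_apply k).comp ha)))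
    refine measurable_snoc hp (measurable_pi_iff.2 fun k => ?_)
    exact ((measurable_pi_apply k).comp ha).prodMk (((env.measurable_context t k).comp hz).prodMk
      ((env.measurable_sample t k).comp (hz.prodMk measurable_const)))

/-- What the environment sees when it answers the prediction `w` of the oracle of box `i`. -/
def simulatedState (A : CPB n d) (env : Environment n d) (ω : A.Outcome env) (i : Fin n) (t : ℕ)
    (p : (Fin t → Move d) × Vec d) : env.Seed × History n d t :=
  (ω.1, A.simulate env ω i t p.1,
    Function.update (fun k => (A.act ω t (A.simulate env ω i t p.1) k).1) i p.2)

theorem measurable_simulatedState (A : CPB n d) (env : Environment n d) (ω : A.Outcome env)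
    (i : Fin n) (t : ℕ) : Measurable (A.simulatedState env ω i t) := by
  have hp : Measurable fun p : (Fin t → Move d) × Vec d => A.simulate env ω i t p.1 :=
    (A.measurable_simulate env ω i t).comp measurable_fst
  refine measurable_const.prodMk (hp.prodMk (measurable_update'.comp
    (Measurable.prodMk (measurable_pi_iff.2 fun k => ?_) measurable_snd)))
  exact measurable_fst.comp ((measurable_pi_apply k).comp
    ((A.measurable_act env t).comp (measurable_const.prodMk hp)))

/-- The adversary that the oracle of box `i` faces when the rest of the randomness is fixed. -/
def boxAdversary (A : CPB n d) (env : Environment n d) (ω : A.Outcome env) (i : Fin n) :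
    Adversary d where
  choose t p := (env.context t (A.simulatedState env ω i t p) i,
    env.sample t (A.simulatedState env ω i t p) i (ω.2.1 (t, i)))
  measurable_choose t :=
    ((env.measurable_context t i).comp (A.measurable_simulatedState env ω i t)).prodMk
      ((env.measurable_sample t i).comp
        ((A.measurable_simulatedState env ω i t).prodMk measurable_const))
  norm_input_le t _ := env.norm_context_le t _ i

/-- The environment's seed is frozen in `ω`, so an oblivious environment answers with fixed contexts
and samplers. -/
theorem boxAdversary_respects (A : CPB n d) {env : Environment n d} {am : AdversaryModel}
    (henv : env.Respects am) (ω : A.Outcome env) (i : Fin n) :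
    (A.boxAdversary env ω i).Respects am := by
  cases am with
  | adaptive => trivial
  | oblivious =>
    intro t p p'
    obtain ⟨h1, -, h3⟩ := henv t ω.1 (A.simulatedState env ω i t p).2
      (A.simulatedState env ω i t p').2
    exact Prod.ext (congrFun h1 i) (congrFun (congrFun h3 i) _)

/-- The outcome with a new seed for the oracle of box `i`. -/
def reseed (A : CPB n d) (env : Environment n d) (i : Fin n)
    (p : A.Outcome env × (A.oracle i).Seed) : A.Outcome env :=
  (p.1.1, p.1.2.1, Function.update p.1.2.2 i p.2)

theorem act_reseed_of_ne (A : CPB n d) (env : Environment n d) (ω : A.Outcome env) {i k : Fin n}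
    (hk : k ≠ i) (s : (A.oracle i).Seed) (t : ℕ) (past : Fin t → Fin n → Round d) :
    A.act (A.reseed env i (ω, s)) t past k = A.act ω t past k := by
  simp [act, reseed, hk]

theorem act_reseed_self (A : CPB n d) (env : Environment n d) (ω : A.Outcome env) (i : Fin n)
    (s : (A.oracle i).Seed) (t : ℕ) (past : Fin t → Fin n → Round d) :
    A.act (A.reseed env i (ω, s)) t past i =
      (A.oracle i).act A.feedback t s fun j => past j i := by
  simp [act, reseed]

theorem update_act_reseed (A : CPB n d) (env : Environment n d) (ω : A.Outcome env) (i : Fin n)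
    (s : (A.oracle i).Seed) (t : ℕ) (past : Fin t → Fin n → Round d) :
    Function.update (A.act ω t past) i (A.act (A.reseed env i (ω, s)) t past i) =
      A.act (A.reseed env i (ω, s)) t past := by
  refine Function.update_eq_iff.2 ⟨rfl, fun k hk => (A.act_reseed_of_ne env ω hk s t past).symm⟩

/-- Feeding the true moves of oracle `i` into the simulation reproduces the run: the other oracles
have unchanged seeds, and the old seed of oracle `i` is overridden everywhere. -/
theorem simulate_reseed (A : CPB n d) (env : Environment n d) (ω : A.Outcome env) (i : Fin n)
    (s : (A.oracle i).Seed) (t : ℕ) :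
    (A.simulate env ω i t fun j => (A.transcript env (A.reseed env i (ω, s)) t j i).1) =
      A.transcript env (A.reseed env i (ω, s)) t := by
  induction t with
  | zero => exact funext fun j => j.elim0
  | succ t ih =>
    simp only [simulate, transcript, Fin.snoc_castSucc, Fin.snoc_last]
    rw [ih, update_act_reseed]
    rfl

theorem boxAdversary_choose_reseed (A : CPB n d) (env : Environment n d) (ω : A.Outcome env)
    (i : Fin n) (s : (A.oracle i).Seed) (t : ℕ) :
    (A.boxAdversary env ω i).choose t
        (fun j => (A.transcript env (A.reseed env i (ω, s)) t j i).1,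
          A.prediction env t (A.reseed env i (ω, s)) i) =
      (A.context env t (A.reseed env i (ω, s)) i, A.value env t (A.reseed env i (ω, s)) i) := by
  have h : A.simulatedState env ω i t
        (fun j => (A.transcript env (A.reseed env i (ω, s)) t j i).1,
          A.prediction env t (A.reseed env i (ω, s)) i) =
      A.state env t (A.reseed env i (ω, s)) := by
    simp only [simulatedState, simulate_reseed, state]
    refine congrArg (fun q => ((ω.1, A.transcript env (A.reseed env i (ω, s)) t, q) :
      env.Seed × History n d t)) ?_
    refine Function.update_eq_iff.2 ⟨rfl, fun k hk => ?_⟩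
    simp only [prediction, A.act_reseed_of_ne env ω hk]
  simp only [boxAdversary, h]
  rfl

/-- The single-box game and box `i` of the full run agree round by round, so the oracle's regret
guarantee speaks about the run. -/
theorem oracle_transcript_boxAdversary (A : CPB n d) (env : Environment n d) (ω : A.Outcome env)
    (i : Fin n) (s : (A.oracle i).Seed) (t : ℕ) :
    (A.oracle i).transcript A.feedback (A.boxAdversary env ω i) s t =
      fun j => A.transcript env (A.reseed env i (ω, s)) t j i := by
  induction t with
  | zero => exact funext fun j => j.elim0
  | succ t ih =>
    have h := A.boxAdversary_choose_reseed env ω i s t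
    rw [prediction, act_reseed_self] at h
    funext j
    refine Fin.lastCases ?_ (fun j => ?_) j
    · simp only [Oracle.transcript, transcript, Fin.snoc_last, ih]
      rw [h, act_reseed_self]
      rfl
    · simp only [Oracle.transcript, transcript, Fin.snoc_castSucc, ih]

theorem transcript_apply (A : CPB n d) (env : Environment n d) (ω : A.Outcome env) (T : ℕ)
    (t : Fin T) (i : Fin n) :
    A.transcript env ω T t i = ((A.prediction env t ω i, A.requested env t ω i),
      A.context env t ω i, A.value env t ω i) := by
  induction T with
  | zero => exact t.elim0
  | succ T ih =>
    refine Fin.lastCases ?_ (fun t => ?_) t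
    · simp only [transcript, Fin.snoc_last]
      rfl
    · simp only [transcript, Fin.snoc_castSucc, ih]
      rfl

/-- The excess loss of the oracle of box `i` in round `t`. -/
def excessLoss (A : CPB n d) (env : Environment n d) (wstar : Fin n → Vec d) (t : ℕ)
    (i : Fin n) (ω : A.Outcome env) : ℝ :=
  linQuadLoss (A.cost i) (A.estimate env t ω i - A.value env t ω i)
    - linQuadLoss (A.cost i) (A.optimal env wstar t ω i - A.value env t ω i)

/-- The price that the oracle of box `i` pays in round `t` for information. -/
def requestCost (A : CPB n d) (env : Environment n d) (t : ℕ) (i : Fin n)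
    (ω : A.Outcome env) : ℝ :=
  if A.requested env t ω i = true then A.feedback.acquisitionCost (A.cost i) else 0

theorem oracle_regret_boxAdversary (A : CPB n d) (env : Environment n d) (ω : A.Outcome env)
    (i : Fin n) (s : (A.oracle i).Seed) (wstar : Fin n → Vec d) (T : ℕ) :
    (A.oracle i).regret A.feedback (A.boxAdversary env ω i) A.h (A.cost i)
        (A.feedback.acquisitionCost (A.cost i)) T (wstar i) s =
      ∑ t ∈ Finset.range T, (A.excessLoss env wstar t i (A.reseed env i (ω, s))
        + A.requestCost env t i (A.reseed env i (ω, s))) := by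
  simp only [Oracle.regret, oracle_transcript_boxAdversary, transcript_apply]
  rw [← Finset.sum_sub_distrib, Finset.sum_add_distrib,
    Finset.sum_range fun t => A.excessLoss env wstar t i (A.reseed env i (ω, s)),
    Finset.sum_range fun t => A.requestCost env t i (A.reseed env i (ω, s))]
  congr 1
  simp only [requestCost, ← Finset.sum_filter, Finset.sum_const, nsmul_eq_mul]
  rw [mul_comm]

end CPB

/-! ### The law of the values in one round. -/

namespace Environment

variable {n d : ℕ}

theorem isProbabilityMeasure_dist (env : Environment n d) (t : ℕ) (z : env.Seed × History n d t)
    (i : Fin n) : IsProbabilityMeasure (env.dist t z i) := by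
  rw [← env.map_sample]
  exact Measure.isProbabilityMeasure_map
    ((env.measurable_sample t i).comp measurable_prodMk_left).aemeasurable

theorem measurable_sample_right (env : Environment n d) (t : ℕ) (z : env.Seed × History n d t)
    (i : Fin n) : Measurable (env.sample t z i) :=
  (env.measurable_sample t i).comp measurable_prodMk_left

/-- The law of the uniform variables that realize the values. -/
abbrev noise (n : ℕ) : Measure (ℕ × Fin n → unitInterval) :=
  Measure.infinitePi fun _ => (volume : Measure unitInterval)

theorem measurePreserving_sample (env : Environment n d) (t : ℕ) (z : env.Seed × History n d t)
    (i : Fin n) :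
    MeasurePreserving (fun u => env.sample t z i (u (t, i))) (noise n) (env.dist t z i) := by
  have h : MeasurePreserving (env.sample t z i) volume (env.dist t z i) :=
    ⟨env.measurable_sample_right t z i, env.map_sample t z i⟩
  exact h.comp (measurePreserving_eval_infinitePi
    (fun _ : ℕ × Fin n => (volume : Measure unitInterval)) (t, i))

/-- Different boxes read different noise coordinates, hence the product law. -/
theorem measurePreserving_sample_pi (env : Environment n d) (t : ℕ)
    (z : env.Seed × History n d t) :
    MeasurePreserving (fun u i => env.sample t z i (u (t, i))) (noise n)
      (Measure.pi (env.dist t z)) := by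
  have := env.isProbabilityMeasure_dist t z
  have hm : Measurable fun (u : ℕ × Fin n → unitInterval) i => env.sample t z i (u (t, i)) :=
    measurable_pi_iff.2 fun i => (env.measurePreserving_sample t z i).measurable
  refine ⟨hm, (Measure.pi_eq fun s hs => ?_).symm⟩
  rw [Measure.map_apply hm (MeasurableSet.univ_pi hs)]
  have h : (fun (u : ℕ × Fin n → unitInterval) i => env.sample t z i (u (t, i))) ⁻¹'
      Set.univ.pi s = ((Finset.univ.map (Function.Embedding.sectR t (Fin n)) : Finset _) :
        Set (ℕ × Fin n)).pi fun p => env.sample t z p.2 ⁻¹' s p.2 := by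
    ext u
    simp
  rw [h, Measure.infinitePi_pi _ fun p _ => env.measurable_sample_right t z p.2 (hs p.2),
    Finset.prod_map]
  refine Finset.prod_congr rfl fun i _ => ?_
  rw [← env.map_sample, Measure.map_apply (env.measurable_sample_right t z i) (hs i)]
  rfl

end Environment

/-! ### Redrawing the values of one round. -/

namespace CPB

variable {n d : ℕ}

open Environment (noise)

instance (A : CPB n d) (env : Environment n d) : IsProbabilityMeasure (A.prob env) := by
  unfold prob
  infer_instance

theorem measurePreserving_reseed (A : CPB n d) (env : Environment n d) (i : Fin n) :
    MeasurePreserving (A.reseed env i) ((A.prob env).prod (A.oracle i).law) (A.prob env) := by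
  have h1 := measurePreserving_prodAssoc env.law
    ((noise n).prod (Measure.pi fun i => (A.oracle i).law)) (A.oracle i).law
  have h2 := measurePreserving_prodAssoc (noise n) (Measure.pi fun i => (A.oracle i).law)
    (A.oracle i).law
  have h3 := (MeasurePreserving.id (noise n)).prod
    (measurePreserving_update (fun i => (A.oracle i).law) i)
  exact ((MeasurePreserving.id env.law).prod (h3.comp h2)).comp h1

/-- The outcome with new values in round `t`. -/
def resample (A : CPB n d) (env : Environment n d) (t : ℕ)
    (p : A.Outcome env × (ℕ × Fin n → unitInterval)) : A.Outcome env :=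
  (p.1.1, fun q => if q.1 = t then p.2 q else p.1.2.1 q, p.1.2.2)

theorem measurePreserving_resample (A : CPB n d) (env : Environment n d) (t : ℕ) :
    MeasurePreserving (A.resample env t) ((A.prob env).prod (noise n)) (A.prob env) := by
  have h1 := measurePreserving_prodAssoc env.law
    ((noise n).prod (Measure.pi fun i => (A.oracle i).law)) (noise n)
  have h2 := measurePreserving_prodAssoc (noise n) (Measure.pi fun i => (A.oracle i).law)
    (noise n)
  have h3 := (MeasurePreserving.id (noise n)).prod
    (Measure.measurePreserving_swap (μ := Measure.pi fun i => (A.oracle i).law) (ν := noise n))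
  have h4 := (measurePreserving_prodAssoc (noise n) (noise n)
    (Measure.pi fun i => (A.oracle i).law)).symm
  have h5 := (measurePreserving_ite_infinitePi
    (fun _ : ℕ × Fin n => (volume : Measure unitInterval)) fun q => q.1 = t).prod
      (MeasurePreserving.id (Measure.pi fun i => (A.oracle i).law))
  exact ((MeasurePreserving.id env.law).prod (h5.comp (h4.comp (h3.comp h2)))).comp h1

/-- The first `k ≤ t` rounds read only noise with round index below `t`. -/
theorem transcript_resample (A : CPB n d) (env : Environment n d) (t : ℕ)
    (p : A.Outcome env × (ℕ × Fin n → unitInterval)) {k : ℕ} (hk : k ≤ t) :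
    A.transcript env (A.resample env t p) k = A.transcript env p.1 k := by
  induction k with
  | zero => exact funext fun j => j.elim0
  | succ k ih =>
    have ha : ∀ past, A.act (A.resample env t p) k past = A.act p.1 k past := fun _ => rfl
    have hu : ∀ i, (A.resample env t p).2.1 (k, i) = p.1.2.1 (k, i) := fun i => by
      simp [resample, (Nat.lt_of_succ_le hk).ne]
    simp only [transcript, ih (Nat.le_of_succ_le hk), ha, hu]
    rfl

theorem state_resample (A : CPB n d) (env : Environment n d) (t : ℕ)
    (p : A.Outcome env × (ℕ × Fin n → unitInterval)) :
    A.state env t (A.resample env t p) = A.state env t p.1 := by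
  unfold state prediction
  rw [A.transcript_resample env t p le_rfl]
  rfl

theorem estimate_resample (A : CPB n d) (env : Environment n d) (t : ℕ)
    (p : A.Outcome env × (ℕ × Fin n → unitInterval)) :
    A.estimate env t (A.resample env t p) = A.estimate env t p.1 := by
  funext i
  simp only [estimate, context, prediction, A.state_resample env t p,
    A.transcript_resample env t p le_rfl]
  rfl

theorem optimal_resample (A : CPB n d) (env : Environment n d) (wstar : Fin n → Vec d) (t : ℕ)
    (p : A.Outcome env × (ℕ × Fin n → unitInterval)) :
    A.optimal env wstar t (A.resample env t p) = A.optimal env wstar t p.1 := by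
  funext i
  simp only [optimal, context, A.state_resample env t p]

theorem value_resample (A : CPB n d) (env : Environment n d) (t : ℕ)
    (p : A.Outcome env × (ℕ × Fin n → unitInterval)) (i : Fin n) :
    A.value env t (A.resample env t p) i = env.sample t (A.state env t p.1) i (p.2 (t, i)) := by
  simp only [value, A.state_resample env t p]
  simp [resample]

theorem integrable_comp_resample (A : CPB n d) (env : Environment n d) (t : ℕ)
    {f : A.Outcome env → ℝ} (hf : Integrable f (A.prob env)) :
    Integrable (fun p => f (A.resample env t p)) ((A.prob env).prod (noise n)) :=
  (A.measurePreserving_resample env t).integrable_comp_of_integrable hf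

theorem integral_integral_resample (A : CPB n d) (env : Environment n d) (t : ℕ)
    {f : A.Outcome env → ℝ} (hf : Integrable f (A.prob env)) :
    ∫ ω, ∫ u, f (A.resample env t (ω, u)) ∂(noise n) ∂(A.prob env) = ∫ ω, f ω ∂(A.prob env) := by
  rw [← integral_prod _ (A.integrable_comp_resample env t hf)]
  exact (A.measurePreserving_resample env t).integral_comp_of_aestronglyMeasurable
    hf.aestronglyMeasurable

theorem ae_integrable_dist (A : CPB n d) (env : Environment n d) (t : ℕ) (i : Fin n)
    (hv : Integrable (fun ω => A.value env t ω i) (A.prob env)) :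
    ∀ᵐ ω ∂(A.prob env), Integrable (fun v => v) (A.dist env t ω i) := by
  filter_upwards [(A.integrable_comp_resample env t hv).prod_right_ae] with ω hω
  simp only [value_resample] at hω
  have h := env.measurePreserving_sample t (A.state env t ω) i
  rw [dist, ← h.map_eq]
  exact (integrable_map_measure aestronglyMeasurable_id h.measurable.aemeasurable).2 hω

/-- Reservation values fixed before the values of round `t` are drawn make `weitz` a conditional
expectation of the realized cost; integration over the redrawn noise stands in for conditioning. -/
theorem weitz_dist_eq [NeZero n] (A : CPB n d) (env : Environment n d) (t : ℕ)
    {τ : A.Outcome env → Fin n → ℝ}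
    (hτ : ∀ p, τ (A.resample env t p) = τ p.1) (ω : A.Outcome env) :
    weitz (A.dist env t ω) (τ ω) A.cost = ∫ u, weitzmanCost A.cost (τ (A.resample env t (ω, u)))
      (A.value env t (A.resample env t (ω, u))) ∂(noise n) := by
  have hm : Measurable fun v => weitzmanCost A.cost (τ ω) v :=
    measurable_const.weitzmanCost A.cost measurable_id'
  have hd : A.dist env t ω = env.dist t (A.state env t ω) := rfl
  rw [weitz, hd, ← (env.measurePreserving_sample_pi t
    (A.state env t ω)).integral_comp_of_aestronglyMeasurable hm.aestronglyMeasurable]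
  refine integral_congr_ae (Eventually.of_forall fun u => ?_)
  simp only [hτ]
  congr 1
  funext i
  rw [value_resample]

theorem integrable_weitzmanCost_value [NeZero n] (A : CPB n d) (env : Environment n d) (t : ℕ)
    {τ : A.Outcome env → Fin n → ℝ} (hτm : Measurable τ)
    (hv : ∀ i, Integrable (fun ω => A.value env t ω i) (A.prob env)) :
    Integrable (fun ω => weitzmanCost A.cost (τ ω) (A.value env t ω)) (A.prob env) := by
  refine Integrable.mono' (g := fun ω => ∑ i, |A.value env t ω i| + ∑ i, |A.cost i|)
    ((integrable_finsetSum _ fun i _ => (hv i).abs).add (integrable_const _)) ?_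
    (Eventually.of_forall fun ω => abs_weitzmanCost_le _ _ _)
  exact (hτm.weitzmanCost A.cost
    (measurable_pi_iff.2 fun i => A.measurable_value env t i)).aestronglyMeasurable

theorem integrable_weitz [NeZero n] (A : CPB n d) (env : Environment n d) (t : ℕ)
    {τ : A.Outcome env → Fin n → ℝ} (hτm : Measurable τ)
    (hτ : ∀ p, τ (A.resample env t p) = τ p.1)
    (hv : ∀ i, Integrable (fun ω => A.value env t ω i) (A.prob env)) :
    Integrable (fun ω => weitz (A.dist env t ω) (τ ω) A.cost) (A.prob env) := by
  simp only [A.weitz_dist_eq env t hτ]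
  exact (A.integrable_comp_resample env t
    (A.integrable_weitzmanCost_value env t hτm hv)).integral_prod_left

theorem integral_weitz [NeZero n] (A : CPB n d) (env : Environment n d) (t : ℕ)
    {τ : A.Outcome env → Fin n → ℝ} (hτm : Measurable τ)
    (hτ : ∀ p, τ (A.resample env t p) = τ p.1)
    (hv : ∀ i, Integrable (fun ω => A.value env t ω i) (A.prob env)) :
    ∫ ω, weitz (A.dist env t ω) (τ ω) A.cost ∂(A.prob env) =
      ∫ ω, weitzmanCost A.cost (τ ω) (A.value env t ω) ∂(A.prob env) := by
  simp only [A.weitz_dist_eq env t hτ]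
  exact A.integral_integral_resample env t (A.integrable_weitzmanCost_value env t hτm hv)

/-- The conditional expectation of the excess loss of the oracle of box `i` in round `t`. -/
def meanExcessLoss (A : CPB n d) (env : Environment n d) (wstar : Fin n → Vec d) (t : ℕ)
    (i : Fin n) (ω : A.Outcome env) : ℝ :=
  ∫ v, (linQuadLoss (A.cost i) (A.estimate env t ω i - v)
    - linQuadLoss (A.cost i) (A.optimal env wstar t ω i - v)) ∂(A.dist env t ω i)

theorem meanExcessLoss_eq (A : CPB n d) (env : Environment n d) (wstar : Fin n → Vec d) (t : ℕ)
    (i : Fin n) (ω : A.Outcome env) :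
    A.meanExcessLoss env wstar t i ω =
      ∫ u, A.excessLoss env wstar t i (A.resample env t (ω, u)) ∂(noise n) := by
  have hm : Measurable fun v => linQuadLoss (A.cost i) (A.estimate env t ω i - v)
      - linQuadLoss (A.cost i) (A.optimal env wstar t ω i - v) := by fun_prop
  rw [meanExcessLoss, dist, ← (env.measurePreserving_sample t
    (A.state env t ω) i).integral_comp_of_aestronglyMeasurable hm.aestronglyMeasurable]
  simp only [excessLoss, estimate_resample, optimal_resample, value_resample]

theorem integrable_meanExcessLoss (A : CPB n d) (env : Environment n d) (wstar : Fin n → Vec d)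
    (t : ℕ) (i : Fin n) (h : Integrable (A.excessLoss env wstar t i) (A.prob env)) :
    Integrable (A.meanExcessLoss env wstar t i) (A.prob env) := by
  simp only [funext (A.meanExcessLoss_eq env wstar t i)]
  exact (A.integrable_comp_resample env t h).integral_prod_left

theorem integral_meanExcessLoss (A : CPB n d) (env : Environment n d) (wstar : Fin n → Vec d)
    (t : ℕ) (i : Fin n) (h : Integrable (A.excessLoss env wstar t i) (A.prob env)) :
    ∫ ω, A.meanExcessLoss env wstar t i ω ∂(A.prob env) =
      ∫ ω, A.excessLoss env wstar t i ω ∂(A.prob env) := by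
  simp only [A.meanExcessLoss_eq env wstar t i]
  exact A.integral_integral_resample env t h

end CPB

/-! ### Request costs and the oracle guarantee inside the run. -/

theorem FeedbackModel.acquisitionCost_nonneg (fm : FeedbackModel) {c : ℝ} (hc : 0 ≤ c) :
    0 ≤ fm.acquisitionCost c := by
  cases fm with
  | fullInformation => exact le_rfl
  | costly => exact hc

namespace CPB

variable {n d : ℕ}

theorem measurable_excessLoss (A : CPB n d) (env : Environment n d)
    (hh : Measurable fun p : Vec d × Vec d => A.h p.1 p.2) (wstar : Fin n → Vec d) (t : ℕ)
    (i : Fin n) : Measurable (A.excessLoss env wstar t i) :=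
  ((measurable_linQuadLoss _).comp
    ((A.measurable_estimate env hh t i).sub (A.measurable_value env t i))).sub
  ((measurable_linQuadLoss _).comp
    ((A.measurable_optimal env hh wstar t i).sub (A.measurable_value env t i)))

theorem measurable_requestCost (A : CPB n d) (env : Environment n d) (t : ℕ) (i : Fin n) :
    Measurable (A.requestCost env t i) :=
  Measurable.ite (A.measurable_requested env t i (measurableSet_singleton true))
    measurable_const measurable_const

theorem requestCost_nonneg (A : CPB n d) (env : Environment n d) {i : Fin n} (hc : 0 ≤ A.cost i)
    (t : ℕ) (ω : A.Outcome env) : 0 ≤ A.requestCost env t i ω := by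
  unfold requestCost
  split_ifs
  · exact A.feedback.acquisitionCost_nonneg hc
  · exact le_rfl

theorem integrable_requestCost (A : CPB n d) (env : Environment n d) (t : ℕ) (i : Fin n) :
    Integrable (A.requestCost env t i) (A.prob env) := by
  refine Integrable.of_bound (A.measurable_requestCost env t i).aestronglyMeasurable
    ‖A.feedback.acquisitionCost (A.cost i)‖ (Eventually.of_forall fun ω => ?_)
  unfold requestCost
  split_ifs
  · exact le_rfl
  · simp

theorem extraCost_nonneg (A : CPB n d) (env : Environment n d) (hc : ∀ i, 0 ≤ A.cost i) (t : ℕ)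
    (ω : A.Outcome env) : 0 ≤ A.extraCost env t ω := by
  unfold extraCost
  split
  · exact le_rfl
  · exact Finset.sum_nonneg fun i _ => hc i

theorem extraCost_le (A : CPB n d) (env : Environment n d) (hc : ∀ i, 0 ≤ A.cost i) (t : ℕ)
    (ω : A.Outcome env) : A.extraCost env t ω ≤ ∑ i, A.requestCost env t i ω := by
  unfold extraCost
  split
  · exact Finset.sum_nonneg fun i _ => A.requestCost_nonneg env (hc i) t ω
  · next h =>
    simp only [requestCost, h, FeedbackModel.acquisitionCost, ← Finset.sum_filter]
    exact Finset.sum_le_sum_of_subset_of_nonneg Finset.sdiff_subset fun i _ _ => hc i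

theorem measurable_extraCost (A : CPB n d) (env : Environment n d)
    (hh : Measurable fun p : Vec d × Vec d => A.h p.1 p.2) (t : ℕ) :
    Measurable (A.extraCost env t) := by
  classical
  unfold extraCost
  split
  · exact measurable_const
  · have h : (fun ω => ∑ i ∈ (Finset.univ.filter fun i => A.requested env t ω i = true) \
        weitzmanOpened (A.estimate env t ω) (A.value env t ω), A.cost i) = fun ω =>
        ∑ i, if A.requested env t ω i = true ∧
          i ∉ weitzmanOpened (A.estimate env t ω) (A.value env t ω) then A.cost i else 0 := by
      funext ω
      rw [← Finset.sum_filter]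
      refine Finset.sum_congr (Finset.ext fun i => ?_) fun _ _ => rfl
      simp
    rw [h]
    refine Finset.measurable_sum _ fun i _ => Measurable.ite ?_ measurable_const measurable_const
    refine (A.measurable_requested env t i (measurableSet_singleton true)).inter
      (MeasurableSet.compl ?_)
    have hm : Measurable fun ω => (A.estimate env t ω, A.value env t ω) :=
      (measurable_pi_iff.2 fun i => A.measurable_estimate env hh t i).prodMk
        (measurable_pi_iff.2 fun i => A.measurable_value env t i)
    exact hm (measurableSet_mem_weitzmanOpened i)

theorem integrable_extraCost (A : CPB n d) (env : Environment n d) (hc : ∀ i, 0 ≤ A.cost i)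
    (hh : Measurable fun p : Vec d × Vec d => A.h p.1 p.2) (t : ℕ) :
    Integrable (A.extraCost env t) (A.prob env) :=
  Integrable.mono' (integrable_finsetSum _ fun i _ => A.integrable_requestCost env t i)
    (A.measurable_extraCost env hh t).aestronglyMeasurable (Eventually.of_forall fun ω => by
      rw [Real.norm_of_nonneg (A.extraCost_nonneg env hc t ω)]
      exact A.extraCost_le env hc t ω)

/-- The regret guarantee of the oracle of box `i`, transferred to the run of CPB. -/
theorem oracleRegret_integrable_and_le (A : CPB n d) (env : Environment n d)
    {am : AdversaryModel} {W : Set (Vec d)} {Y : Set ℝ} {wstar : Fin n → Vec d} {T : ℕ}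
    (hh : Measurable fun p : Vec d × Vec d => A.h p.1 p.2)
    (hA : A.Admissible env am W Y wstar T) {i : Fin n} (hc : 0 ≤ A.cost i) {R : ℝ}
    (hO : (A.oracle i).AchievesRegret A.feedback am A.h W Y (A.cost i) T R) :
    Integrable (fun ω => ∑ t ∈ Finset.range T,
      (A.excessLoss env wstar t i ω + A.requestCost env t i ω)) (A.prob env) ∧
    ∫ ω, ∑ t ∈ Finset.range T,
      (A.excessLoss env wstar t i ω + A.requestCost env t i ω) ∂(A.prob env) ≤ R := by
  set f : A.Outcome env → ℝ := fun ω => ∑ t ∈ Finset.range T,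
    (A.excessLoss env wstar t i ω + A.requestCost env t i ω) with hf
  set g : A.Outcome env → ℝ := fun ω => ∑ t ∈ Finset.range T,
    (|linQuadLoss (A.cost i) (A.optimal env wstar t ω i - A.value env t ω i)|
      + A.cost i ^ 2 / 2) with hg
  have hfm : Measurable f := Finset.measurable_sum _ fun t _ =>
    (A.measurable_excessLoss env hh wstar t i).add (A.measurable_requestCost env t i)
  have hgi : Integrable g (A.prob env) := integrable_finsetSum _ fun t ht =>
    (hA.integrable_loss t (Finset.mem_range.1 ht) i).abs.add (integrable_const _)
  have hle : ∀ ω, -g ω ≤ f ω := by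
    intro ω
    rw [hf, hg, ← Finset.sum_neg_distrib]
    refine Finset.sum_le_sum fun t _ => ?_
    have h1 := A.requestCost_nonneg env hc t ω
    have h2 := neg_half_sq_le_linQuadLoss hc (A.estimate env t ω i - A.value env t ω i)
    have h3 := le_abs_self (linQuadLoss (A.cost i) (A.optimal env wstar t ω i - A.value env t ω i))
    unfold excessLoss
    linarith
  have hre := A.measurePreserving_reseed env i
  have hbox : ∀ ω s, f (A.reseed env i (ω, s)) = (A.oracle i).regret A.feedback
      (A.boxAdversary env ω i) A.h (A.cost i) (A.feedback.acquisitionCost (A.cost i)) T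
      (wstar i) s := fun ω s => (A.oracle_regret_boxAdversary env ω i s wstar T).symm
  -- The guarantee is applied for each frozen `ω`; only the fresh seed of oracle `i` is random.
  have hO' := fun ω => hO (A.boxAdversary env ω i) (A.boxAdversary_respects hA.respects ω i)
    (fun t z => hA.sample_mem t _ i _) (wstar i) (hA.wstar_mem i)
  obtain ⟨h1, h2⟩ := integrable_prod_of_forall_section_le (R := R) (hfm.comp hre.measurable)
    (hre.integrable_comp_of_integrable hgi) (fun p => hle _)
    (fun ω => by simpa only [Function.comp_apply, hbox] using (hO' ω).1)
    (fun ω => by simpa only [Function.comp_apply, hbox] using (hO' ω).2)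
  refine ⟨(hre.integrable_comp hfm.aestronglyMeasurable).1 h1, ?_⟩
  rw [← hre.integral_comp_of_aestronglyMeasurable hfm.aestronglyMeasurable]
  exact h2

/-- The guarantee only concerns the sum over rounds. Adding an integrable term makes every summand
nonnegative, so each one is dominated by the sum. -/
theorem integrable_excessLoss (A : CPB n d) (env : Environment n d)
    {am : AdversaryModel} {W : Set (Vec d)} {Y : Set ℝ} {wstar : Fin n → Vec d} {T : ℕ}
    (hh : Measurable fun p : Vec d × Vec d => A.h p.1 p.2)
    (hA : A.Admissible env am W Y wstar T) {i : Fin n} (hc : 0 ≤ A.cost i) {R : ℝ}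
    (hO : (A.oracle i).AchievesRegret A.feedback am A.h W Y (A.cost i) T R) {t : ℕ} (ht : t < T) :
    Integrable (A.excessLoss env wstar t i) (A.prob env) := by
  have hB : ∀ s ∈ Finset.range T, Integrable (fun ω =>
      |linQuadLoss (A.cost i) (A.optimal env wstar s ω i - A.value env s ω i)|
        + A.cost i ^ 2 / 2) (A.prob env) := fun s hs =>
    (hA.integrable_loss s (Finset.mem_range.1 hs) i).abs.add (integrable_const _)
  have hle : ∀ s ω, 0 ≤ A.excessLoss env wstar s i ω +
      (|linQuadLoss (A.cost i) (A.optimal env wstar s ω i - A.value env s ω i)|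
        + A.cost i ^ 2 / 2) := by
    intro s ω
    have h2 := neg_half_sq_le_linQuadLoss hc (A.estimate env s ω i - A.value env s ω i)
    have h3 := le_abs_self (linQuadLoss (A.cost i) (A.optimal env wstar s ω i - A.value env s ω i))
    unfold excessLoss
    linarith
  refine Integrable.mono' ((A.oracleRegret_integrable_and_le env hh hA hc hO).1.abs.add
    ((integrable_finsetSum _ hB).const_mul 2))
    (A.measurable_excessLoss env hh wstar t i).aestronglyMeasurable
    (Eventually.of_forall fun ω => ?_)
  have ht' := Finset.mem_range.2 ht
  have h1 := Finset.single_le_sum (fun s _ => hle s ω) ht'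
  have h2 : |linQuadLoss (A.cost i) (A.optimal env wstar t ω i - A.value env t ω i)|
        + A.cost i ^ 2 / 2 ≤ ∑ s ∈ Finset.range T,
      (|linQuadLoss (A.cost i) (A.optimal env wstar s ω i - A.value env s ω i)|
        + A.cost i ^ 2 / 2) :=
    Finset.single_le_sum (f := fun s =>
      |linQuadLoss (A.cost i) (A.optimal env wstar s ω i - A.value env s ω i)|
        + A.cost i ^ 2 / 2) (fun s _ => by positivity) ht'
  have h3 : 0 ≤ |linQuadLoss (A.cost i) (A.optimal env wstar t ω i - A.value env t ω i)|
        + A.cost i ^ 2 / 2 := by positivity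
  have h4 : 0 ≤ ∑ s ∈ Finset.range T, A.requestCost env s i ω :=
    Finset.sum_nonneg fun s _ => A.requestCost_nonneg env hc s ω
  have h5 := le_abs_self (∑ s ∈ Finset.range T,
    (A.excessLoss env wstar s i ω + A.requestCost env s i ω))
  have h6 := abs_nonneg (∑ s ∈ Finset.range T,
    (A.excessLoss env wstar s i ω + A.requestCost env s i ω))
  have h7 := hle t ω
  rw [Finset.sum_add_distrib] at h1
  simp only [Pi.add_apply]
  rw [Finset.sum_add_distrib (f := fun s => A.excessLoss env wstar s i ω)] at h5 h6 ⊢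
  exact abs_le.2 ⟨by linarith, by linarith⟩

/-! ### From excess losses to regret. -/

theorem weitz_sub_weitz_le [NeZero n] (A : CPB n d) (env : Environment n d)
    {wstar : Fin n → Vec d} (hr : env.Realizable A.h A.cost wstar) {t : ℕ} {ω : A.Outcome env}
    (hD : ∀ i, Integrable (fun v => v) (A.dist env t ω i)) {η : ℝ} (hη : 0 < η) :
    weitz (A.dist env t ω) (A.estimate env t ω) A.cost
        - weitz (A.dist env t ω) (A.optimal env wstar t ω) A.cost
      ≤ ∑ i, (η / 2 + η⁻¹ * A.meanExcessLoss env wstar t i ω) := by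
  have : ∀ i, IsProbabilityMeasure (A.dist env t ω i) :=
    env.isProbabilityMeasure_dist t (A.state env t ω)
  refine (weitz_sub_le _ hD _ _ _).trans (Finset.sum_le_sum fun i _ => ?_)
  exact abs_sub_integral_relu_le (hD i) (hr t (A.state env t ω) i) _ hη

theorem meanExcessLoss_nonneg (A : CPB n d) (env : Environment n d)
    {wstar : Fin n → Vec d} (hr : env.Realizable A.h A.cost wstar) {t : ℕ} {i : Fin n}
    {ω : A.Outcome env} (hD : Integrable (fun v => v) (A.dist env t ω i)) :
    0 ≤ A.meanExcessLoss env wstar t i ω := by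
  have : IsProbabilityMeasure (A.dist env t ω i) :=
    env.isProbabilityMeasure_dist t (A.state env t ω) i
  exact le_trans (by positivity)
    (sq_sub_le_integral_linQuadLoss_sub hD (hr t (A.state env t ω) i) _)

theorem integrable_playCost_sub_weitz [NeZero n] (A : CPB n d) (env : Environment n d)
    {am : AdversaryModel} {W : Set (Vec d)} {Y : Set ℝ} {wstar : Fin n → Vec d} {T : ℕ}
    (hh : Measurable fun p : Vec d × Vec d => A.h p.1 p.2)
    (hA : A.Admissible env am W Y wstar T) {t : ℕ} (ht : t < T) :
    Integrable (fun ω => A.playCost env t ω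
      - weitz (A.dist env t ω) (A.optimal env wstar t ω) A.cost) (A.prob env) :=
  (A.integrable_weitzmanCost_value env t
    (measurable_pi_iff.2 fun i => A.measurable_estimate env hh t i)
    (hA.integrable_value t ht)).sub
  (A.integrable_weitz env t (measurable_pi_iff.2 fun i => A.measurable_optimal env hh wstar t i)
    (A.optimal_resample env wstar t) (hA.integrable_value t ht))

theorem integral_playCost_sub_weitz_le [NeZero n] (A : CPB n d) (env : Environment n d)
    {am : AdversaryModel} {W : Set (Vec d)} {Y : Set ℝ} {wstar : Fin n → Vec d} {T : ℕ}
    (hh : Measurable fun p : Vec d × Vec d => A.h p.1 p.2)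
    (hA : A.Admissible env am W Y wstar T) {t : ℕ} (ht : t < T)
    (hL : ∀ i, Integrable (A.excessLoss env wstar t i) (A.prob env)) {η : ℝ} (hη : 0 < η) :
    ∫ ω, (A.playCost env t ω
        - weitz (A.dist env t ω) (A.optimal env wstar t ω) A.cost) ∂(A.prob env)
      ≤ ∑ i, (η / 2 + η⁻¹ * ∫ ω, A.excessLoss env wstar t i ω ∂(A.prob env)) := by
  have hv := hA.integrable_value t ht
  have hem : Measurable (A.estimate env t) :=
    measurable_pi_iff.2 fun i => A.measurable_estimate env hh t i
  have hom : Measurable (A.optimal env wstar t) :=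
    measurable_pi_iff.2 fun i => A.measurable_optimal env hh wstar t i
  have hp : Integrable (A.playCost env t) (A.prob env) :=
    A.integrable_weitzmanCost_value env t hem hv
  have he := A.integrable_weitz env t hem (A.estimate_resample env t) hv
  have ho := A.integrable_weitz env t hom (A.optimal_resample env wstar t) hv
  have hm := fun i => A.integrable_meanExcessLoss env wstar t i (hL i)
  have hs : ∀ i ∈ Finset.univ, Integrable
      (fun ω => η / 2 + η⁻¹ * A.meanExcessLoss env wstar t i ω) (A.prob env) := fun i _ =>
    (integrable_const _).add ((hm i).const_mul _)
  -- In expectation the realized cost equals `weitz` at the estimates, which are fixed before the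
  -- values of the round.
  calc _ = ∫ ω, (weitz (A.dist env t ω) (A.estimate env t ω) A.cost
        - weitz (A.dist env t ω) (A.optimal env wstar t ω) A.cost) ∂(A.prob env) := by
        rw [integral_sub hp ho, integral_sub he ho,
          A.integral_weitz env t hem (A.estimate_resample env t) hv]
        rfl
    _ ≤ ∫ ω, ∑ i, (η / 2 + η⁻¹ * A.meanExcessLoss env wstar t i ω) ∂(A.prob env) := by
        refine integral_mono_ae (he.sub ho) (integrable_finsetSum _ hs) ?_
        filter_upwards [ae_all_iff.2 fun i => A.ae_integrable_dist env t i (hv i)] with ω hω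
        exact A.weitz_sub_weitz_le env hA.realizable hω hη
    _ = _ := by
        rw [integral_finsetSum _ hs]
        refine Finset.sum_congr rfl fun i _ => ?_
        rw [integral_add (integrable_const _) ((hm i).const_mul _), integral_const_mul,
          A.integral_meanExcessLoss env wstar t i (hL i)]
        simp

/-- Both regrets are integrable. For every `η > 0`, their expectations are bounded in terms of the
regret of the oracles; the extra boxes are covered by that regret if `η ≤ 1`. -/
theorem regret_bounds [NeZero n] (A : CPB n d) (env : Environment n d)
    {am : AdversaryModel} {W : Set (Vec d)} {Y : Set ℝ} {wstar : Fin n → Vec d} {T : ℕ}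
    (hh : Measurable fun p : Vec d × Vec d => A.h p.1 p.2) (hc : ∀ i, 0 ≤ A.cost i)
    (hA : A.Admissible env am W Y wstar T) {R : ℝ}
    (hO : ∀ i, (A.oracle i).AchievesRegret A.feedback am A.h W Y (A.cost i) T R) :
    Integrable (A.playRegret env wstar T) (A.prob env) ∧
    Integrable (A.regret env wstar T) (A.prob env) ∧ 0 ≤ R ∧
    ∀ η > 0, ∫ ω, A.playRegret env wstar T ω ∂(A.prob env) ≤ n * (T * η / 2 + η⁻¹ * R) ∧
      (η ≤ 1 → ∫ ω, A.regret env wstar T ω ∂(A.prob env) ≤ n * (T * η / 2 + η⁻¹ * R)) := by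
  have hP : ∀ t ∈ Finset.range T, Integrable (fun ω => A.playCost env t ω
      - weitz (A.dist env t ω) (A.optimal env wstar t ω) A.cost) (A.prob env) := fun t ht =>
    A.integrable_playCost_sub_weitz env hh hA (Finset.mem_range.1 ht)
  have hE := A.integrable_extraCost env hc hh
  have hQ := A.integrable_requestCost env
  have hL : ∀ i, ∀ t ∈ Finset.range T, Integrable (A.excessLoss env wstar t i) (A.prob env) :=
    fun i t ht => A.integrable_excessLoss env hh hA (hc i) (hO i) (Finset.mem_range.1 ht)
  have hplay : Integrable (A.playRegret env wstar T) (A.prob env) := integrable_finsetSum _ hP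
  have hsplit : A.regret env wstar T = fun ω =>
      A.playRegret env wstar T ω + ∑ t ∈ Finset.range T, A.extraCost env t ω := by
    funext ω
    simp only [regret, playRegret, ← Finset.sum_add_distrib]
    exact Finset.sum_congr rfl fun t _ => by ring
  have hextra : Integrable (fun ω => ∑ t ∈ Finset.range T, A.extraCost env t ω) (A.prob env) :=
    integrable_finsetSum _ fun t _ => hE t
  set D : Fin n → ℝ := fun i =>
    ∑ t ∈ Finset.range T, ∫ ω, A.excessLoss env wstar t i ω ∂(A.prob env) with hDdef
  set N : Fin n → ℝ := fun i =>
    ∑ t ∈ Finset.range T, ∫ ω, A.requestCost env t i ω ∂(A.prob env) with hNdef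
  -- Single excess losses may be negative; their conditional means are not. With `hN0` and `hDN`
  -- this yields `0 ≤ R`.
  have hD0 : ∀ i, 0 ≤ D i := fun i => Finset.sum_nonneg fun t ht => by
    rw [← A.integral_meanExcessLoss env wstar t i (hL i t ht)]
    refine integral_nonneg_of_ae ?_
    filter_upwards [A.ae_integrable_dist env t i
      (hA.integrable_value t (Finset.mem_range.1 ht) i)] with ω hω
    exact A.meanExcessLoss_nonneg env hA.realizable hω
  have hN0 : ∀ i, 0 ≤ N i := fun i => Finset.sum_nonneg fun t _ =>
    integral_nonneg fun ω => A.requestCost_nonneg env (hc i) t ω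
  have hDN : ∀ i, D i + N i ≤ R := fun i => by
    have h := (A.oracleRegret_integrable_and_le env hh hA (hc i) (hO i)).2
    have hLQ : ∀ t ∈ Finset.range T, Integrable
        (fun ω => A.excessLoss env wstar t i ω + A.requestCost env t i ω) (A.prob env) :=
      fun t ht => (hL i t ht).add (hQ t i)
    rw [integral_finsetSum _ hLQ] at h
    rw [hDdef, hNdef, ← Finset.sum_add_distrib]
    refine le_of_eq_of_le (Finset.sum_congr rfl fun t ht => ?_) h
    exact (integral_add (hL i t ht) (hQ t i)).symm
  have hplayle : ∀ η > 0, ∫ ω, A.playRegret env wstar T ω ∂(A.prob env) ≤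
      ∑ i, (T * η / 2 + η⁻¹ * D i) := fun η hη => by
    simp only [playRegret]
    rw [integral_finsetSum _ hP]
    refine (Finset.sum_le_sum fun t ht => A.integral_playCost_sub_weitz_le env hh hA
      (Finset.mem_range.1 ht) (fun i => hL i t ht) hη).trans_eq ?_
    rw [Finset.sum_comm]
    refine Finset.sum_congr rfl fun i _ => ?_
    rw [Finset.sum_add_distrib, ← Finset.mul_sum, Finset.sum_const, Finset.card_range,
      nsmul_eq_mul]
    ring
  have hextrale : ∫ ω, ∑ t ∈ Finset.range T, A.extraCost env t ω ∂(A.prob env) ≤ ∑ i, N i := by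
    rw [integral_finsetSum _ fun t _ => hE t, hNdef, Finset.sum_comm]
    refine Finset.sum_le_sum fun t _ => ?_
    rw [← integral_finsetSum _ fun i _ => hQ t i]
    exact integral_mono (hE t) (integrable_finsetSum _ fun i _ => hQ t i)
      fun ω => A.extraCost_le env hc t ω
  have hsum : ∀ x : ℝ, (n : ℝ) * x = ∑ _i : Fin n, x := fun x => by simp
  refine ⟨hplay, hsplit ▸ hplay.add hextra,
    by linarith [hDN 0, hD0 0, hN0 0], fun η hη => ⟨(hplayle η hη).trans ?_, fun hη1 => ?_⟩⟩
  · rw [hsum]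
    refine Finset.sum_le_sum fun i _ => add_le_add_right ?_ _
    exact mul_le_mul_of_nonneg_left (by linarith [hDN i, hN0 i]) (inv_nonneg.2 hη.le)
  · rw [hsplit, integral_add hplay hextra, hsum]
    refine (add_le_add (hplayle η hη) hextrale).trans ?_
    rw [← Finset.sum_add_distrib]
    refine Finset.sum_le_sum fun i _ => ?_
    -- The only use of `η ≤ 1`: the request costs fit into the same `η⁻¹ * R`.
    have h1 : N i ≤ η⁻¹ * N i := le_mul_of_one_le_left (hN0 i) ((one_le_inv₀ hη).2 hη1)
    have h2 := mul_le_mul_of_nonneg_left (hDN i) (inv_nonneg.2 hη.le)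
    linarith

end CPB

/-! ### The choice of `η` and the final bounds. -/

/-- The choice `η = √(R/T)` gives `3/2 * √(T R)`, but exceeds `1` when `R > T`. For `T < R ≤ 2T`, `η
= 1` still costs at most `2 * √(T R)`. The slack `ε` is for `R = 0`, where `η` has to tend to `0`.
-/
theorem exists_pos_mul_add_inv_mul_le {T R : ℝ} (hT : 0 < T) (hR : 0 ≤ R) {ε : ℝ} (hε : 0 < ε) :
    ∃ η > 0, T * η / 2 + η⁻¹ * R ≤ 2 * √(T * R) + ε ∧ (R ≤ 2 * T → η ≤ 1) := by
  rcases hR.eq_or_lt with rfl | hR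
  · refine ⟨min 1 (ε / T), by positivity, ?_, fun _ => min_le_left _ _⟩
    have h1 : T * min 1 (ε / T) ≤ ε := by
      have := mul_le_mul_of_nonneg_left (min_le_right 1 (ε / T)) hT.le
      rwa [mul_div_cancel₀ _ hT.ne'] at this
    simp only [mul_zero, Real.sqrt_zero]
    linarith
  · rw [Real.sqrt_mul hT.le]
    have hx : 0 < √T := Real.sqrt_pos.2 hT
    have hy : 0 < √R := Real.sqrt_pos.2 hR
    have hx2 := Real.sq_sqrt hT.le
    have hy2 := Real.sq_sqrt hR.le
    by_cases h : T < R ∧ R ≤ 2 * T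
    · refine ⟨1, one_pos, ?_, fun _ => le_rfl⟩
      have hxy : √T ≤ √R := Real.sqrt_le_sqrt h.1.le
      -- Since `2 ≤ (3/2)²`. Together with `√T ≤ √R` this places `√R` where `T/2 + R ≤ 2 * √T * √R`
      -- holds.
      have h2 : √R ≤ 3 / 2 * √T := by
        refine abs_le_of_sq_le_sq' ?_ (by positivity) |>.2
        nlinarith [h.2]
      rw [inv_one, one_mul]
      nlinarith [mul_nonneg (sub_nonneg.2 hxy) (sub_nonneg.2 h2)]
    · refine ⟨√R / √T, by positivity, ?_, fun h2 => ?_⟩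
      · have h1 : T * (√R / √T) / 2 + (√R / √T)⁻¹ * R = 3 / 2 * (√T * √R) := by
          rw [← hx2, ← hy2, Real.sqrt_sq hx.le, Real.sqrt_sq hy.le]
          field_simp
          ring
        rw [h1]
        nlinarith [mul_pos hx hy]
      · rw [div_le_one hx]
        refine Real.sqrt_le_sqrt ?_
        by_contra h3
        exact h ⟨not_le.1 h3, h2⟩

theorem CPB.regret_le_two_mul_sqrt {n d : ℕ} [NeZero n] (A : CPB n d) (env : Environment n d)
    {am : AdversaryModel} {W : Set (Vec d)} {Y : Set ℝ} {wstar : Fin n → Vec d} {T : ℕ}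
    (hh : Measurable fun p : Vec d × Vec d => A.h p.1 p.2) (hc : ∀ i, 0 ≤ A.cost i)
    (hA : A.Admissible env am W Y wstar T) {R : ℝ}
    (hO : ∀ i, (A.oracle i).AchievesRegret A.feedback am A.h W Y (A.cost i) T R) :
    Integrable (A.playRegret env wstar T) (A.prob env) ∧
    Integrable (A.regret env wstar T) (A.prob env) ∧
    ∫ ω, A.playRegret env wstar T ω ∂(A.prob env) ≤ 2 * n * √(T * R) ∧
    (A.feedback = FeedbackModel.fullInformation ∨ R ≤ 2 * T →
      ∫ ω, A.regret env wstar T ω ∂(A.prob env) ≤ 2 * n * √(T * R)) := by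
  obtain ⟨h1, h2, hR, hη⟩ := A.regret_bounds env hh hc hA hO
  have hn : 0 < (n : ℝ) := Nat.cast_pos.2 (NeZero.pos n)
  have hplay : ∫ ω, A.playRegret env wstar T ω ∂(A.prob env) ≤ 2 * n * √(T * R) := by
    rcases Nat.eq_zero_or_pos T with rfl | hT
    · simp [playRegret]
    · refine le_of_forall_pos_le_add fun ε hε => ?_
      obtain ⟨η, h0, hle, -⟩ := exists_pos_mul_add_inv_mul_le (T := T) (Nat.cast_pos.2 hT) hR
        (div_pos hε hn)
      have h3 := mul_le_mul_of_nonneg_left hle hn.le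
      rw [mul_add (n : ℝ) (2 * √(T * R)), mul_div_cancel₀ _ hn.ne'] at h3
      linarith [(hη η h0).1]
  refine ⟨h1, h2, hplay, fun h => ?_⟩
  rcases h with h | h
  · have he : A.regret env wstar T = A.playRegret env wstar T := by
      funext ω
      simp only [regret, playRegret]
      refine Finset.sum_congr rfl fun t _ => ?_
      have : A.extraCost env t ω = 0 := by
        unfold extraCost
        split
        · rfl
        · next h' => simp [h] at h'
      rw [this, add_zero]
    rwa [he]
  · rcases Nat.eq_zero_or_pos T with rfl | hT
    · simp [regret]
    · refine le_of_forall_pos_le_add fun ε hε => ?_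
      obtain ⟨η, h0, hle, h1⟩ := exists_pos_mul_add_inv_mul_le (T := T) (Nat.cast_pos.2 hT) hR
        (div_pos hε hn)
      have h3 := mul_le_mul_of_nonneg_left hle hn.le
      rw [mul_add (n : ℝ) (2 * √(T * R)), mul_div_cancel₀ _ hn.ne'] at h3
      linarith [(hη η h0).2 (h1 h)]

end

theorem mainTheorem1 {n d : ℕ} [NeZero n] (h : Vec d → Vec d → ℝ)
    (hh : Measurable fun p : Vec d × Vec d => h p.1 p.2)
    (W : Set (Vec d)) (Y : Set ℝ) (c : Fin n → ℝ) (hc : ∀ i, 0 < c i)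
    (fm : FeedbackModel) (am : AdversaryModel)
    -- `O a T` is the oracle for the loss `H_a` and the horizon `T`
    (O : ℝ → ℕ → Oracle d) (r : ℕ → ℝ)
    (hO : ∀ T i, (O (c i) T).AchievesRegret fm am h W Y (c i) T (r T)) :
    (∀ (T : ℕ) (env : Environment n d) (wstar : Fin n → Vec d) (A : CPB n d),
      A = CPB.ofOracle h c fm (fun a => O a T) →
      A.Admissible env am W Y wstar T →
        Integrable (A.playRegret env wstar T) (A.prob env) ∧
        Integrable (A.regret env wstar T) (A.prob env) ∧
        ∫ ω, A.playRegret env wstar T ω ∂(A.prob env) ≤ 2 * n * √(T * r T) ∧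
        (fm = FeedbackModel.fullInformation ∨ r T ≤ 2 * T →
          ∫ ω, A.regret env wstar T ω ∂(A.prob env) ≤ 2 * n * √(T * r T))) ∧
    (r =o[atTop] (fun T : ℕ => (T : ℝ)) →
      ∀ ε > 0, ∀ᶠ T : ℕ in atTop, ∀ (env : Environment n d) (wstar : Fin n → Vec d)
        (A : CPB n d), A = CPB.ofOracle h c fm (fun a => O a T) →
        A.Admissible env am W Y wstar T →
          ∫ ω, A.regret env wstar T ω ∂(A.prob env) ≤ ε * T) := by
  have key : ∀ (T : ℕ) (env : Environment n d) (wstar : Fin n → Vec d) (A : CPB n d),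
      A = CPB.ofOracle h c fm (fun a => O a T) →
      A.Admissible env am W Y wstar T →
        Integrable (A.playRegret env wstar T) (A.prob env) ∧
        Integrable (A.regret env wstar T) (A.prob env) ∧
        ∫ ω, A.playRegret env wstar T ω ∂(A.prob env) ≤ 2 * n * √(T * r T) ∧
        (fm = FeedbackModel.fullInformation ∨ r T ≤ 2 * T →
          ∫ ω, A.regret env wstar T ω ∂(A.prob env) ≤ 2 * n * √(T * r T)) := by
    rintro T env wstar A rfl hA
    exact CPB.regret_le_two_mul_sqrt _ env hh (fun i => (hc i).le) hA (hO T)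
  refine ⟨key, fun hr ε hε => ?_⟩
  have hn : 0 < (n : ℝ) := Nat.cast_pos.2 (NeZero.pos n)
  -- The `2` secures `r T ≤ 2 * T`, as the costly model needs; the square makes `2 * n * √(T * δ T)`
  -- at most `ε * T`.
  set δ : ℝ := min 2 ((ε / (2 * n)) ^ 2) with hδ
  have hδ0 : 0 < δ := by positivity
  filter_upwards [hr.bound hδ0] with T hT env wstar A hAeq hA
  have hT0 : (0 : ℝ) ≤ T := T.cast_nonneg
  rw [Real.norm_of_nonneg hT0] at hT
  have hrT : r T ≤ δ * T := (le_abs_self _).trans hT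
  have h2 : r T ≤ 2 * T := hrT.trans (mul_le_mul_of_nonneg_right (min_le_left _ _) hT0)
  refine ((key T env wstar A hAeq hA).2.2.2 (.inr h2)).trans ?_
  have h3 : √(T * r T) ≤ ε / (2 * n) * T := by
    refine Real.sqrt_le_iff.2 ⟨by positivity, ?_⟩
    have h4 : r T ≤ (ε / (2 * n)) ^ 2 * T :=
      hrT.trans (mul_le_mul_of_nonneg_right (min_le_right _ _) hT0)
    nlinarith [mul_le_mul_of_nonneg_left h4 hT0]
  calc 2 * n * √(T * r T) ≤ 2 * n * (ε / (2 * n) * T) := by gcongr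
    _ = ε * T := by field_simp
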